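/- Let $R$ be a commutative Noetherian ring, $H$ a Hopf $R$-algebra with comultiplication $\Delta$, counit $\varepsilon$ and antipode $S$ (bijectivity of $S$ or existence of a twisted antipode is not assumed), and $A$ an associative unital $R$-algebra; write $\Delta(h)=\sum h_1\otimes h_2$, $H^*=\mathrm{Hom}_R(H,R)$, and $\star$ for convolution products. Let $H\otimes_R A\to A$, $h\otimes a\mapsto ha$, be a weak left $H$-action, i.e. an $R$-linear map with $1_Ha=a$ such that $a\mapsto[h\mapsto ha]$ is a unital algebra morphism $A\to(\mathrm{Hom}_R(H,A),\star)$. Let $\sigma\in\mathrm{Hom}_R(H\otimes_R H,A)$ be convolution-invertible with inverse $\sigma^{-1}$, and assume that $A\#_\sigma H:=A\otimes_R H$ with the multiplication $$(a\#h)(\tilde a\#\tilde h)=\sum a(h_1\tilde a)\,\sigma(h_2\otimes\tilde h_1)\#h_3\tilde h_2$$ is associative with unity $1_A\#1_H$ (a right $H$-crossed product with invertible cocycle). It is a right $H$-comodule algebra via $\mathrm{id}\otimes\Delta$, and $H$ is one via $\Delta$. Let $U\subseteq H^*$ be a left $H$-module subalgebra, that is, an $R$-submodule closed under $\star$ and under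 the left regular action $(hf)(k)=f(kh)$ (it may or may not contain the unity $\varepsilon$ of $H^*$). For a right $H$-comodule algebra $B$, with coaction $b\mapsto\sum b_{\langle0\rangle}\otimes b_{\langle1\rangle}$, the opposite smash product $B\#^{op}U$ is $B\otimes_R U$ with the multiplication $$(b\#f)(\tilde b\#\tilde f)=\sum b_{\langle0\rangle}\tilde b\,\#\,\big((b_{\langle1\rangle}\tilde f)\star f\big).$$ For $f\in H^*$ and $k\in H$ put $f\rightharpoonup k=\sum k_1f(k_2)$ and $k\leftharpoonup f=\sum f(k_1)k_2$. Assume that there is an $R$-submodule $V\subseteq H^*$ such that $(V,U)$ is compatible, i.e.: 1. for all $h\in H$ and $a\in A$, the maps $H\to A$ given by $$\tilde h\mapsto\sum[\tilde h_1a]\,\sigma(\tilde h_2\otimes h),\qquad \tilde h\mapsto\sum\sigma^{-1}(S(\tilde h_3)\otimes\tilde h_4)\,[S(\tilde h_2)a]\,\sigma(S(\tilde h_1)\otimes\tilde h_5h)$$ lie in the image of $J:A\otimes_R V\to\mathrm{Hom}_R(H,A)$, $J(a\otimes g)(\tilde h)=a\,g(\tilde h)$; 2. for every $g\in V$ there are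 finitely many $(h_j,g_j)\in H\times U$ with $k\leftharpoonup g=\sum_j(g_j\rightharpoonup k)h_j$ for all $k\in H$. Then: (a) If $U\subseteq R^H$ (the module of all functions $H\to R$) is $A\otimes_R H$-pure, i.e. the canonical map $U\otimes_R(A\otimes_R H)\to R^H\otimes_R(A\otimes_R H)$ is injective, then there is an isomorphism of $R$-algebras $$(A\#_\sigma H)\#^{op}U\;\simeq\;A\otimes_R(H\#^{op}U),$$ that is, an $R$-linear multiplicative bijection; if $\varepsilon\in U$, it maps the unity $(1_A\#1_H)\#\varepsilon$ to the unity $1_A\otimes(1_H\#\varepsilon)$. (b) The purity hypothesis of (a) holds, in particular, if $H$ is a Hopf $\alpha$-algebra and $U$ is an $R$-subbialgebra of $H^\circ$. Here $H^\circ=\{f\in H^*: HfH\text{ is finitely generated over }R\}$, where $HfH$ is the $R$-submodule generated by the maps $k\mapsto f(akb)$ with $a,b\in H$; a submodule $K\subseteq M$ is pure if it is $N$-pure ($K\otimes_RN\to M\otimes_RN$ injective) for every $R$-module $N$; $H$ is a Hopf $\alpha$-algebra if $H^\circ\subseteq R^H$ is pure; and $U$ is an $R$-subbialgebra of $H^\circ$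 if it is a pure submodule of $H^\circ$ containing $\varepsilon$, closed under $\star$, and for each $f\in U$ the form $h\otimes k\mapsto f(hk)$ comes from an element of $U\otimes_RU$. -/

import Mathlib

open TensorProduct Coalgebra WithConv

universe u v w x

noncomputable section

namespace OppositeSmash

/-! ### Crossed products -/

section CrossedProduct

variable {R : Type u} {H : Type v} {A : Type w}
variable [CommRing R] [Ring H] [HopfAlgebra R H] [Ring A] [Algebra R A]

/-- A weak left `H`-action on `A`: an `R`-bilinear map `(h, a) ↦ h a` such that
`a ↦ [h ↦ h a]` is a unital algebra morphism from `A` to the convolution algebra `Hom_R(H, A)`,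
and `1_H a = a` for all `a`. -/
structure WeakAction (R : Type u) (H : Type v) (A : Type w) [CommRing R] [Ring H]
    [HopfAlgebra R H] [Ring A] [Algebra R A] where
  /-- the map `h ↦ a ↦ h a` -/
  act : H →ₗ[R] A →ₗ[R] A
  conv_one : toConv (act.flip 1) = 1
  conv_mul : ∀ a b : A, toConv (act.flip (a * b)) = toConv (act.flip a) * toConv (act.flip b)
  one_act : ∀ a : A, act 1 a = a

/-- The map `h ⊗ k ↦ ∑ σ(h₁ ⊗ k₁) ⊗ h₂ k₂`. -/
def cocycleMul (σ : H ⊗[R] H →ₗ[R] A) : H ⊗[R] H →ₗ[R] A ⊗[R] H :=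
  TensorProduct.map σ (LinearMap.mul' R H) ∘ₗ comul

/-- The map `(a, h₁ ⊗ h₂) ↦ [ã ⊗ k ↦ ∑ a (h₁ ã) σ(h₂ ⊗ k₁) ⊗ h₃ k₂]`. -/
def crossedMulAux (ω : WeakAction R H A) (σ : H ⊗[R] H →ₗ[R] A) (a : A) :
    H ⊗[R] H →ₗ[R] A ⊗[R] H →ₗ[R] A ⊗[R] H :=
  TensorProduct.lift (LinearMap.mk₂ R
    (fun h₁ h₂ => TensorProduct.lift
      ((Algebra.lsmul R R (A ⊗[R] H)).toLinearMap.compl₁₂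
        (LinearMap.mulLeft R a ∘ₗ ω.act h₁)
        (cocycleMul σ ∘ₗ TensorProduct.mk R H H h₂)))
    (by intros; ext; simp [mul_add])
    (by intros; ext; simp [smul_smul])
    (by intros; ext; simp)
    (by intros; ext; simp))

/-- The multiplication `(a # h)(ã # k) = ∑ a (h₁ ã) σ(h₂ ⊗ k₁) # h₃ k₂` on `A ⊗ H`. -/
def crossedMul (ω : WeakAction R H A) (σ : H ⊗[R] H →ₗ[R] A) :
    A ⊗[R] H →ₗ[R] A ⊗[R] H →ₗ[R] A ⊗[R] H :=
  TensorProduct.lift (LinearMap.mk₂ R (fun a h => crossedMulAux ω σ a (comul h))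
    (by
      intro a b h
      induction comul (R := R) h using TensorProduct.induction_on with
      | zero => simp
      | tmul x y => ext; simp [crossedMulAux, add_mul]
      | add x y hx hy => simp only [map_add, hx, hy]; abel)
    (by
      intro c a h
      induction comul (R := R) h using TensorProduct.induction_on with
      | zero => simp
      | tmul x y => ext; simp [crossedMulAux]
      | add x y hx hy => simp only [map_add, hx, hy, smul_add])
    (by intros; simp)
    (by intros; simp))

/-- The module `A ⊗ H`, to be equipped with the multiplication of `A #_σ H`. -/
def CrossedProduct (_ω : WeakAction R H A) (_σ : H ⊗[R] H →ₗ[R] A) : Type (max w v) :=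
  A ⊗[R] H

namespace CrossedProduct

variable (ω : WeakAction R H A) (σ : H ⊗[R] H →ₗ[R] A)

instance : AddCommGroup (CrossedProduct ω σ) := inferInstanceAs (AddCommGroup (A ⊗[R] H))

instance : Module R (CrossedProduct ω σ) := inferInstanceAs (Module R (A ⊗[R] H))

/-- The multiplication is the one of `crossedMul`; it is neither associative nor unital in
general. -/
instance : NonUnitalNonAssocRing (CrossedProduct ω σ) where
  mul x y := crossedMul ω σ x y
  left_distrib x y z := map_add (crossedMul ω σ x) y z
  right_distrib x y z := LinearMap.congr_fun (map_add (crossedMul ω σ) x y) z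
  zero_mul x := LinearMap.congr_fun (map_zero (crossedMul ω σ)) x
  mul_zero x := map_zero (crossedMul ω σ x)

instance : IsScalarTower R (CrossedProduct ω σ) (CrossedProduct ω σ) where
  smul_assoc r x y := LinearMap.congr_fun (map_smul (crossedMul ω σ) r x) y

instance : SMulCommClass R (CrossedProduct ω σ) (CrossedProduct ω σ) where
  smul_comm r x y := (map_smul (crossedMul ω σ x) r y).symm

/-- The element `a # h` of `A #_σ H`. -/
def mk (a : A) (h : H) : CrossedProduct ω σ := (a ⊗ₜ[R] h : A ⊗[R] H)

/-- The coaction `id ⊗ Δ : A #_σ H → (A #_σ H) ⊗ H`, `a # h ↦ ∑ (a # h₁) ⊗ h₂`. -/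
def coaction : CrossedProduct ω σ →ₗ[R] CrossedProduct ω σ ⊗[R] H :=
  ((TensorProduct.assoc R A H H).symm.toLinearMap ∘ₗ (comul (R := R) (A := H)).lTensor A :
    A ⊗[R] H →ₗ[R] (A ⊗[R] H) ⊗[R] H)

end CrossedProduct

/-- `A #_σ H` is a right `H`-crossed product: the multiplication is associative with
unity `1_A # 1_H`. -/
structure IsCrossedProduct (ω : WeakAction R H A) (σ : H ⊗[R] H →ₗ[R] A) : Prop where
  mul_assoc : ∀ x y z : CrossedProduct ω σ, x * y * z = x * (y * z)
  one_mul : ∀ x : CrossedProduct ω σ, CrossedProduct.mk ω σ 1 1 * x = x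
  mul_one : ∀ x : CrossedProduct ω σ, x * CrossedProduct.mk ω σ 1 1 = x

end CrossedProduct

/-! ### Left `H`-module subalgebras of `H*` and opposite smash products -/

section Smash

variable {R : Type u} {H : Type v} [CommRing R] [Ring H] [HopfAlgebra R H]

/-- The dual `H* = Hom_R(H, R)` with the convolution product. -/
abbrev ConvDual (R : Type u) (H : Type v) [CommRing R] [Ring H] [HopfAlgebra R H] :
    Type (max u v) :=
  WithConv (H →ₗ[R] R)

/-- The left regular action of `H` on `H*`: `(h f)(k) = f(k h)`. -/
def leftRegular : H →ₗ[R] ConvDual R H →ₗ[R] ConvDual R H :=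
  LinearMap.mk₂ R (fun h f => toConv (f.ofConv ∘ₗ LinearMap.mulRight R h))
    (by intros; ext; simp [mul_add]) (by intros; ext; simp)
    (by intros; ext; simp) (by intros; ext; simp)

/-- A left `H`-module subalgebra `U ⊆ H*`: an `R`-submodule closed under the convolution product
and under the left regular `H`-action. It need not contain the unity `ε` of `H*`. -/
structure LeftModuleSubalgebra (R : Type u) (H : Type v) [CommRing R] [Ring H]
    [HopfAlgebra R H] extends NonUnitalSubalgebra R (ConvDual R H) where
  leftRegular_mem' : ∀ (h : H) {f : ConvDual R H}, f ∈ carrier → leftRegular h f ∈ carrier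

namespace LeftModuleSubalgebra

variable (U : LeftModuleSubalgebra R H)

/-- The left regular action of `H` on `U`. -/
def act : H →ₗ[R] U.toNonUnitalSubalgebra →ₗ[R] U.toNonUnitalSubalgebra :=
  LinearMap.mk₂ R (fun h f => ⟨leftRegular h f.1, U.leftRegular_mem' h f.2⟩)
    (by intros; ext1; simp) (by intros; ext1; simp)
    (by intros; ext1; simp) (by intros; ext1; simp)

end LeftModuleSubalgebra

variable {B : Type x} [NonUnitalNonAssocRing B] [Module R B] [IsScalarTower R B B]
  [SMulCommClass R B B]

/-- The map `(f, b ⊗ h) ↦ [b' ⊗ f' ↦ b b' ⊗ (h f') ⋆ f]`. -/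
def opMulAux (U : LeftModuleSubalgebra R H) (f : U.toNonUnitalSubalgebra) :
    B ⊗[R] H →ₗ[R] B ⊗[R] U.toNonUnitalSubalgebra →ₗ[R] B ⊗[R] U.toNonUnitalSubalgebra :=
  TensorProduct.lift (LinearMap.mk₂ R
    (fun b h => TensorProduct.map (LinearMap.mulLeft R b) (LinearMap.mulRight R f ∘ₗ U.act h))
    (by intros; ext; simp [add_mul, TensorProduct.add_tmul])
    (by intros; ext; simp [TensorProduct.smul_tmul', smul_mul_assoc])
    (by intros; ext; simp [add_mul, TensorProduct.tmul_add])
    (by intros; ext; simp))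

/-- The multiplication `(b # f)(b' # f') = ∑ b₍₀₎ b' # ((b₍₁₎ f') ⋆ f)` on `B ⊗ U`, for a
coaction `ρ(b) = ∑ b₍₀₎ ⊗ b₍₁₎` of `H` on `B`. -/
def opMul (ρ : B →ₗ[R] B ⊗[R] H) (U : LeftModuleSubalgebra R H) :
    B ⊗[R] U.toNonUnitalSubalgebra →ₗ[R]
      B ⊗[R] U.toNonUnitalSubalgebra →ₗ[R] B ⊗[R] U.toNonUnitalSubalgebra :=
  TensorProduct.lift (LinearMap.mk₂ R (fun b f => opMulAux U f (ρ b))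
    (by intros; simp) (by intros; simp)
    (by
      intro b f g
      induction ρ b using TensorProduct.induction_on with
      | zero => simp
      | tmul x y => ext; simp [opMulAux, mul_add, TensorProduct.tmul_add]
      | add x y hx hy => simp only [map_add, hx, hy]; abel)
    (by
      intro c b f
      induction ρ b using TensorProduct.induction_on with
      | zero => simp
      | tmul x y => ext; simp [opMulAux, mul_smul_comm]
      | add x y hx hy => simp only [map_add, hx, hy, smul_add]))

/-- The opposite smash product `B #^op U` of a right `H`-comodule algebra `(B, ρ)` and a left
`H`-module subalgebra `U ⊆ H*`: the module `B ⊗ U` with the multiplication `opMul`. -/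
def OpSmash (_ρ : B →ₗ[R] B ⊗[R] H) (U : LeftModuleSubalgebra R H) : Type (max x u v) :=
  B ⊗[R] U.toNonUnitalSubalgebra

namespace OpSmash

variable (ρ : B →ₗ[R] B ⊗[R] H) (U : LeftModuleSubalgebra R H)

instance : AddCommGroup (OpSmash ρ U) :=
  inferInstanceAs (AddCommGroup (B ⊗[R] U.toNonUnitalSubalgebra))

instance : Module R (OpSmash ρ U) :=
  inferInstanceAs (Module R (B ⊗[R] U.toNonUnitalSubalgebra))

instance : NonUnitalNonAssocRing (OpSmash ρ U) where
  mul x y := opMul ρ U x y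
  left_distrib x y z := map_add (opMul ρ U x) y z
  right_distrib x y z := LinearMap.congr_fun (map_add (opMul ρ U) x y) z
  zero_mul x := LinearMap.congr_fun (map_zero (opMul ρ U)) x
  mul_zero x := map_zero (opMul ρ U x)

instance : IsScalarTower R (OpSmash ρ U) (OpSmash ρ U) where
  smul_assoc r x y := LinearMap.congr_fun (map_smul (opMul ρ U) r x) y

instance : SMulCommClass R (OpSmash ρ U) (OpSmash ρ U) where
  smul_comm r x y := (map_smul (opMul ρ U x) r y).symm

/-- The element `b # f` of `B #^op U`. -/
def mk (b : B) (f : U.toNonUnitalSubalgebra) : OpSmash ρ U :=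
  (b ⊗ₜ[R] f : B ⊗[R] U.toNonUnitalSubalgebra)

end OpSmash

end Smash

/-! ### Compatibility -/

section Compatible

variable {R : Type u} {H : Type v} {A : Type w}
variable [CommRing R] [Ring H] [HopfAlgebra R H] [Ring A] [Algebra R A]

/-- `φ(h ⊗ a) : h' ↦ ∑ [h'₁ a] σ(h'₂ ⊗ h)`. -/
def phi (ω : WeakAction R H A) (σ : H ⊗[R] H →ₗ[R] A) (h : H) (a : A) : H →ₗ[R] A :=
  LinearMap.mul' R A ∘ₗ
    TensorProduct.map (ω.act.flip a) (σ ∘ₗ (TensorProduct.mk R H H).flip h) ∘ₗ comul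

/-- `h' ↦ ∑ σ⁻¹(S(h'₂) ⊗ h'₃) [S(h'₁) a]`, where `σinv` stands for `σ⁻¹`. -/
def psiInner (ω : WeakAction R H A) (σinv : H ⊗[R] H →ₗ[R] A) (a : A) : H →ₗ[R] A :=
  LinearMap.mul' R A ∘ₗ
    TensorProduct.map
      (σinv ∘ₗ TensorProduct.map (HopfAlgebra.antipode R (A := H)) LinearMap.id ∘ₗ comul)
      (ω.act.flip a ∘ₗ HopfAlgebra.antipode R) ∘ₗ
    (TensorProduct.comm R H H).toLinearMap ∘ₗ comul

/-- `ψ(h ⊗ a) : h' ↦ ∑ σ⁻¹(S(h'₃) ⊗ h'₄) [S(h'₂) a] σ(S(h'₁) ⊗ h'₅ h)`. -/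
def psi (ω : WeakAction R H A) (σ σinv : H ⊗[R] H →ₗ[R] A) (h : H) (a : A) : H →ₗ[R] A :=
  LinearMap.mul' R A ∘ₗ
    TensorProduct.map (psiInner ω σinv a)
      (σ ∘ₗ TensorProduct.map (HopfAlgebra.antipode R) (LinearMap.mulRight R h)) ∘ₗ
    (TensorProduct.leftComm R H H H).toLinearMap ∘ₗ comul.lTensor H ∘ₗ comul

/-- The canonical map `J : A ⊗ V → Hom_R(H, A)`, `a ⊗ g ↦ [h ↦ a g(h)]`. -/
def canonicalJ (A : Type w) [Ring A] [Algebra R A] (V : Submodule R (ConvDual R H)) :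
    A ⊗[R] V →ₗ[R] (H →ₗ[R] A) :=
  TensorProduct.lift ((LinearMap.smulRightₗ (R := R) (M := A) (M₂ := H)).flip.compl₂
    ((WithConv.linearEquiv R (H →ₗ[R] R)).toLinearMap ∘ₗ V.subtype))

/-- `f ⇀ k = ∑ k₁ f(k₂)`. -/
def hitLeft (f : ConvDual R H) : H →ₗ[R] H :=
  (TensorProduct.rid R H).toLinearMap ∘ₗ f.ofConv.lTensor H ∘ₗ comul

/-- `k ↼ f = ∑ f(k₁) k₂`. -/
def hitRight (f : ConvDual R H) : H →ₗ[R] H :=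
  (TensorProduct.lid R H).toLinearMap ∘ₗ f.ofConv.rTensor H ∘ₗ comul

/-- The map `H ⊗ U → End_R(H)`, `h ⊗ g ↦ [k ↦ (g ⇀ k) h]`. -/
def lambdaBar (U : LeftModuleSubalgebra R H) :
    H ⊗[R] U.toNonUnitalSubalgebra →ₗ[R] (H →ₗ[R] H) :=
  TensorProduct.lift (LinearMap.mk₂ R (fun h g => LinearMap.mulRight R h ∘ₗ hitLeft g.1)
    (by intros; ext; simp [mul_add])
    (by intros; ext; simp)
    (by intros; ext; simp [hitLeft, LinearMap.lTensor_add, add_mul])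
    (by intros; ext; simp [hitLeft, LinearMap.lTensor_smul]))

/-- The RL-condition for `(V, U)` with respect to `H`: for every `g ∈ V` the map `k ↦ k ↼ g` has
the form `k ↦ ∑ (g_j ⇀ k) h_j` with finitely many `h_j ∈ H`, `g_j ∈ U`. -/
def RLCondition (V : Submodule R (ConvDual R H)) (U : LeftModuleSubalgebra R H) : Prop :=
  ∀ g ∈ V, hitRight g ∈ LinearMap.range (lambdaBar U)

/-- `(V, U)` is compatible (in the opposite sense) with the crossed product `A #_σ H` with
convolution-invertible `σ`: the images of `φ, ψ : H ⊗ A → Hom_R(H, A)` lie in the image of `J`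
(which, `φ` and `ψ` being bilinear in `(h, a)`, is a condition on pure tensors), and `(V, U)`
satisfies the RL-condition. -/
structure Compatible (ω : WeakAction R H A) (σ : (WithConv (H ⊗[R] H →ₗ[R] A))ˣ)
    (V : Submodule R (ConvDual R H)) (U : LeftModuleSubalgebra R H) : Prop where
  phi_mem : ∀ (h : H) (a : A), phi ω σ.val.ofConv h a ∈ LinearMap.range (canonicalJ A V)
  psi_mem : ∀ (h : H) (a : A),
    psi ω σ.val.ofConv σ.inv.ofConv h a ∈ LinearMap.range (canonicalJ A V)
  rl : RLCondition V U

end Compatible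

/-! ### Purity, finite duals, subbialgebras -/

section Purity

variable {R : Type u} [CommRing R]

/-- A submodule `K ⊆ M` is `N`-pure if `K ⊗ N → M ⊗ N` is injective. -/
def IsNPure {M : Type v} [AddCommMonoid M] [Module R M] (K : Submodule R M)
    (N : Type w) [AddCommGroup N] [Module R N] : Prop :=
  Function.Injective (K.subtype.rTensor N)

/-- A submodule `K ⊆ M` is pure if it is `N`-pure for all modules `N` (of universe `x`). -/
def IsPure {M : Type v} [AddCommMonoid M] [Module R M] (K : Submodule R M) : Prop :=
  ∀ (N : Type x) [AddCommGroup N] [Module R N], IsNPure K N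

variable {H : Type v} [Ring H] [HopfAlgebra R H]

/-- The inclusion `H* → R^H` into the module of all functions `H → R`. -/
def toFunctions (R : Type u) (H : Type v) [CommRing R] [Ring H] [HopfAlgebra R H] :
    ConvDual R H →ₗ[R] (H → R) where
  toFun f h := f.ofConv h
  map_add' _ _ := rfl
  map_smul' _ _ := rfl

/-- The two-sided translate `k ↦ f(a k b)`. -/
def translate (a b : H) : ConvDual R H →ₗ[R] ConvDual R H where
  toFun f := toConv (f.ofConv ∘ₗ LinearMap.mulRight R b ∘ₗ LinearMap.mulLeft R a)
  map_add' _ _ := rfl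
  map_smul' _ _ := rfl

/-- The `H`-subbimodule `H f H` of `H*` generated by `f`. -/
def bimoduleSpan (f : ConvDual R H) : Submodule R (ConvDual R H) :=
  Submodule.span R {g | ∃ a b : H, g = translate a b f}

/-- The finite dual `H° = {f ∈ H* | H f H is finitely generated over R}`, for Noetherian `R`. -/
def finiteDual (R : Type u) (H : Type v) [CommRing R] [IsNoetherianRing R] [Ring H]
    [HopfAlgebra R H] : Submodule R (ConvDual R H) where
  carrier := {f | (bimoduleSpan f).FG}
  zero_mem' := by
    have : bimoduleSpan (0 : ConvDual R H) = ⊥ := by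
      rw [bimoduleSpan, Submodule.span_eq_bot]
      rintro g ⟨a, b, rfl⟩
      exact map_zero _
    simp only [Set.mem_ofPred_eq, this]
    exact Submodule.fg_bot
  add_mem' := by
    intro f g hf hg
    refine Submodule.FG.of_le (hf.sup hg) (Submodule.span_le.2 ?_)
    rintro _ ⟨a, b, rfl⟩
    rw [map_add]
    exact Submodule.add_mem_sup (Submodule.subset_span ⟨a, b, rfl⟩)
      (Submodule.subset_span ⟨a, b, rfl⟩)
  smul_mem' := by
    intro c f hf
    refine Submodule.FG.of_le hf (Submodule.span_le.2 ?_)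
    rintro _ ⟨a, b, rfl⟩
    rw [map_smul]
    exact Submodule.smul_mem _ _ (Submodule.subset_span ⟨a, b, rfl⟩)

/-- `H` is a Hopf `α`-algebra: `H° ⊆ R^H` is pure. -/
def IsHopfAlphaAlgebra (R : Type u) (H : Type v) [CommRing R] [IsNoetherianRing R] [Ring H]
    [HopfAlgebra R H] : Prop :=
  IsPure.{u, max u v, x} ((finiteDual R H).map (toFunctions R H))

/-- `U` is an `R`-subbialgebra of `H°`: a pure submodule of `H°` which contains `ε` (it is closed
under the convolution product already) and whose elements `f` have comultiplication
`[h ⊗ k ↦ f(h k)]` in the image of `U ⊗ U`. -/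
structure IsSubbialgebra [IsNoetherianRing R] (U : LeftModuleSubalgebra R H) : Prop where
  le : U.toSubmodule ≤ finiteDual R H
  pure : IsPure.{u, max u v, x} (U.toSubmodule.submoduleOf (finiteDual R H))
  one_mem : (1 : ConvDual R H) ∈ U.toNonUnitalSubalgebra
  comul_mem : ∀ f ∈ U.toNonUnitalSubalgebra,
    ∃ t : U.toNonUnitalSubalgebra ⊗[R] U.toNonUnitalSubalgebra,
      f.ofConv ∘ₗ LinearMap.mul' R H = TensorProduct.dualDistrib R H H
        (TensorProduct.map
          ((WithConv.linearEquiv R (H →ₗ[R] R)).toLinearMap ∘ₗ U.toSubmodule.subtype)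
          ((WithConv.linearEquiv R (H →ₗ[R] R)).toLinearMap ∘ₗ U.toSubmodule.subtype) t)

end Purity

end OppositeSmash

end

/-! Both algebras act faithfully on the one module `A ⊗ H`, both actions turn products into reversed
compositions, and they have the same image in `End_R(A ⊗ H)`; the isomorphism is the first action
followed by the inverse of the second.

For a comodule algebra `B`, the element `b # f` acts by `c ↦ ∑ c₍₀₎ f(c₍₁₎) b` (`opRep`,
`opRep_mul`). With `B = A #_σ H` this is `crossedRep`; with `B = H`, combined with right
multiplication on `A`, it is `tensorRep`. All these operators are left `A`-linear, hence determined
by their values on the elements `1 ⊗ k`. Restricted there, both take the shape `convRep`: `x ⊗ f`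
goes to `γ * (f x)`, where `γ(k) = 1 ⊗ k`, `f x` denotes `k ↦ f(k) x`, and `*` is convolution for
the crossed product or for the ordinary product of `A ⊗ H`.

Faithfulness: convolving with a left inverse of `γ` reduces `convRep` to the evaluation map
`evalHom`, which is injective because `U` is pure in `R^H` relative to `A ⊗ H` and `R^X ⊗ M → M^X`
is injective over a Noetherian ring (`piTensor_injective`). The left inverse is `1 ⊗ S` for the
ordinary product and `μ(k) = ∑ σ⁻¹(S(k₂) ⊗ k₃) # S(k₁)` (`gammaInv`) for the crossed product.

Equality of images (`range_convRep_eq`): `(1 # p)(a # k) = ∑ φ(k₁ ⊗ a)(p₁) # p₂ k₂`, so the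
condition on `φ` and the RL-condition give one inclusion. For the other, `D(k) = a ⊗ k h` is
rewritten as `γ * (μ * D)`, and `μ * D` is expressed through `ψ`. This needs `μ` to be a right
inverse of `γ` as well, which is obtained without any twisted antipode: `(γ * μ - ε 1) * γ = 0`, and
right convolution by `γ` can be cancelled because `x ⊗ l ↦ ∑ x (1 # l₁) ⊗ l₂` is injective
(`gammaShift_injective`).

The purity statement is transitivity of purity along `U ⊆ H° ⊆ R^H`. -/

noncomputable section

namespace OppositeSmash

open HopfAlgebra (antipode)

/-! ### Convolution along a bilinear map -/

section Convolution

variable {R C M N P M' N' : Type*} [CommRing R] [AddCommGroup C] [Module R C] [Coalgebra R C]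
  [AddCommGroup M] [Module R M] [AddCommGroup N] [Module R N] [AddCommGroup P] [Module R P]
  [AddCommGroup M'] [Module R M'] [AddCommGroup N'] [Module R N']

/-- The convolution `c ↦ ∑ β(F(c₁), G(c₂))` of linear maps along a bilinear map `β`. -/
def bconv (β : M →ₗ[R] N →ₗ[R] P) (F : C →ₗ[R] M) (G : C →ₗ[R] N) : C →ₗ[R] P :=
  TensorProduct.lift (β.compl₁₂ F G) ∘ₗ comul

theorem bconv_apply_repr (β : M →ₗ[R] N →ₗ[R] P) (F : C →ₗ[R] M) (G : C →ₗ[R] N) {c : C}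
    {ι : Type*} (r : Coalgebra.Repr R c ι) :
    bconv β F G c = ∑ i ∈ r.index, β (F (r.left i)) (G (r.right i)) := by
  simp [bconv, ← r.eq]

/-- `bconv` as a bilinear map. -/
def bconvₗ (β : M →ₗ[R] N →ₗ[R] P) : (C →ₗ[R] M) →ₗ[R] (C →ₗ[R] N) →ₗ[R] (C →ₗ[R] P) :=
  LinearMap.mk₂ R (bconv β)
    (by intros; ext c; simp [bconv_apply_repr β _ _ (ℛ R c), Finset.sum_add_distrib])
    (by intros; ext c; simp [bconv_apply_repr β _ _ (ℛ R c), Finset.smul_sum])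
    (by intros; ext c; simp [bconv_apply_repr β _ _ (ℛ R c), Finset.sum_add_distrib])
    (by intros; ext c; simp [bconv_apply_repr β _ _ (ℛ R c), Finset.smul_sum])

@[simp]
theorem bconvₗ_apply (β : M →ₗ[R] N →ₗ[R] P) (F : C →ₗ[R] M) (G : C →ₗ[R] N) :
    bconvₗ β F G = bconv β F G := rfl

theorem comp_finsetSum {ι : Type*} (s : Finset ι) (f : M →ₗ[R] N) (g : ι → P →ₗ[R] M) :
    f ∘ₗ ∑ i ∈ s, g i = ∑ i ∈ s, f ∘ₗ g i := by
  ext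
  simp

theorem finsetSum_comp {ι : Type*} (s : Finset ι) (f : ι → M →ₗ[R] N) (g : P →ₗ[R] M) :
    (∑ i ∈ s, f i) ∘ₗ g = ∑ i ∈ s, f i ∘ₗ g := by
  ext
  simp

theorem sum_bconv (β : M →ₗ[R] N →ₗ[R] P) {ι : Type*} (s : Finset ι) (F : ι → C →ₗ[R] M)
    (G : C →ₗ[R] N) : bconv β (∑ i ∈ s, F i) G = ∑ i ∈ s, bconv β (F i) G := by
  exact LinearMap.map_sum₂ (bconvₗ β) s F G

theorem bconv_sum (β : M →ₗ[R] N →ₗ[R] P) {ι : Type*} (s : Finset ι) (F : C →ₗ[R] M)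
    (G : ι → C →ₗ[R] N) : bconv β F (∑ i ∈ s, G i) = ∑ i ∈ s, bconv β F (G i) :=
  map_sum (bconvₗ β F) G s

/-- Coassociativity: both sides are a sum over `F(c₁), G(c₂), K(c₃)`. The four pairings are
arbitrary, so the same statement serves for algebra products, scalar actions and the formation of
tensors. -/
theorem bconv_assoc {β₁ : M' →ₗ[R] N' →ₗ[R] P} {Q : Type*} [AddCommGroup Q] [Module R Q]
    {β₂ : M →ₗ[R] N →ₗ[R] M'} {β₃ : M →ₗ[R] Q →ₗ[R] P} {β₄ : N →ₗ[R] N' →ₗ[R] Q}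
    (h : ∀ x y z, β₁ (β₂ x y) z = β₃ x (β₄ y z))
    (F : C →ₗ[R] M) (G : C →ₗ[R] N) (K : C →ₗ[R] N') :
    bconv β₁ (bconv β₂ F G) K = bconv β₃ F (bconv β₄ G K) := by
  ext c
  have key := congr(TensorProduct.lift (β₃.compl₁₂ F (TensorProduct.lift (β₄.compl₁₂ G K)))
    $(coassoc_apply (R := R) c))
  have h1 : ∀ z : C ⊗[R] C, TensorProduct.lift (β₁.compl₁₂ (bconv β₂ F G) K) z =
      TensorProduct.lift (β₃.compl₁₂ F (TensorProduct.lift (β₄.compl₁₂ G K)))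
        (TensorProduct.assoc R C C C (comul.rTensor C z)) := by
    intro z
    induction z using TensorProduct.induction_on with
    | zero => simp
    | add x y hx hy => simp only [map_add, hx, hy]
    | tmul x y =>
      simp only [bconv, LinearMap.rTensor_tmul, TensorProduct.lift.tmul, LinearMap.compl₁₂_apply,
        LinearMap.comp_apply]
      induction comul (R := R) x using TensorProduct.induction_on with
      | zero => simp
      | add x y hx hy => simp only [map_add, hx, hy, TensorProduct.add_tmul, LinearMap.add_apply]
      | tmul x y => simp [h]
  have h2 : ∀ z : C ⊗[R] C, TensorProduct.lift (β₃.compl₁₂ F (bconv β₄ G K)) z =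
      TensorProduct.lift (β₃.compl₁₂ F (TensorProduct.lift (β₄.compl₁₂ G K)))
        (comul.lTensor C z) := by
    intro z
    induction z using TensorProduct.induction_on with
    | zero => simp
    | add x y hx hy => simp only [map_add, hx, hy]
    | tmul x y => simp [bconv]
  rw [← h1, ← h2] at key
  exact key

theorem bconv_counit_left {β : M →ₗ[R] N →ₗ[R] P} {F : C →ₗ[R] M} {f : N →ₗ[R] P}
    (h : ∀ c y, β (F c) y = counit (R := R) c • f y) (G : C →ₗ[R] N) : bconv β F G = f ∘ₗ G := by
  ext c
  rw [bconv_apply_repr β F G (ℛ R c)]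
  simp only [h, ← map_smul, ← map_sum, Coalgebra.sum_counit_smul, LinearMap.comp_apply]

theorem sum_smul_counit {c : C} {ι : Type*} (r : Coalgebra.Repr R c ι) :
    ∑ i ∈ r.index, counit (R := R) (r.right i) • r.left i = c := by
  have := congr(TensorProduct.rid R C $(sum_tmul_counit_eq r))
  simpa only [map_sum, TensorProduct.rid_tmul, one_smul] using this

theorem bconv_counit_right {β : M →ₗ[R] N →ₗ[R] P} {G : C →ₗ[R] N} {f : M →ₗ[R] P}
    (h : ∀ x c, β x (G c) = counit (R := R) c • f x) (F : C →ₗ[R] M) : bconv β F G = f ∘ₗ F := by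
  ext c
  rw [bconv_apply_repr β F G (ℛ R c)]
  simp only [h, ← map_smul, ← map_sum, sum_smul_counit, LinearMap.comp_apply]

theorem bconv_mk_id_id : bconv (TensorProduct.mk R C C) .id .id = comul := by
  ext c
  simp [bconv_apply_repr _ _ _ (ℛ R c), (ℛ R c).eq]

theorem comp_bconv {Q : Type*} [AddCommGroup Q] [Module R Q] (f : P →ₗ[R] Q)
    (β : M →ₗ[R] N →ₗ[R] P) (F : C →ₗ[R] M) (G : C →ₗ[R] N) :
    f ∘ₗ bconv β F G = bconv (β.compr₂ f) F G := by
  ext c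
  simp [bconv_apply_repr _ _ _ (ℛ R c)]

theorem bconv_mul_eq {A : Type*} [Ring A] [Algebra R A] (F G : WithConv (C →ₗ[R] A)) :
    bconv (LinearMap.mul R A) F.ofConv G.ofConv = (F * G).ofConv := by
  ext c
  rw [bconv_apply_repr _ _ _ (ℛ R c)]
  exact ((ℛ R c).convMul_apply F G).symm

end Convolution

/-! ### The antipode and iterated coproducts -/

section Antipode

variable {R : Type u} {H : Type v} [CommRing R] [Ring H] [HopfAlgebra R H]

/-- The map `k ↦ ∑ S(k₁) ⊗ k₂`. -/
def antipodeTmul (R : Type u) (H : Type v) [CommRing R] [Ring H] [HopfAlgebra R H] :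
    H →ₗ[R] H ⊗[R] H :=
  TensorProduct.map (antipode R) LinearMap.id ∘ₗ comul

theorem bconv_antipode_id : bconv (LinearMap.mul R H) (antipode R (A := H)) .id =
    Algebra.linearMap R H ∘ₗ counit := by
  have := bconv_mul_eq (R := R) (toConv (antipode R (A := H))) (toConv (LinearMap.id (M := H)))
  rwa [LinearMap.antipode_mul_id] at this

theorem bconv_id_antipode : bconv (LinearMap.mul R H) .id (antipode R (A := H)) =
    Algebra.linearMap R H ∘ₗ counit := by
  have := bconv_mul_eq (R := R) (toConv (LinearMap.id (M := H))) (toConv (antipode R (A := H)))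
  rwa [LinearMap.id_mul_antipode] at this

/-- Both sides are convolution inverses of `Δ` in `Hom_R(H, H ⊗ H)`, so uniqueness of inverses gives
`Δ(S(k)) = ∑ S(k₂) ⊗ S(k₁)`. -/
theorem comul_comp_antipode :
    comul ∘ₗ (antipode R (A := H)) = TensorProduct.map (antipode R) (antipode R) ∘ₗ
      (TensorProduct.comm R H H).toLinearMap ∘ₗ comul := by
  suffices h : toConv (TensorProduct.map (antipode R) (antipode R) ∘ₗ
    (TensorProduct.comm R H H).toLinearMap ∘ₗ comul) *
      toConv (comul (R := R) (A := H)) = 1 from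
    toConv_injective (left_inv_eq_right_inv h LinearMap.comul_right_inv).symm
  have e1 : TensorProduct.map (antipode R) (antipode R) ∘ₗ (TensorProduct.comm R H H).toLinearMap ∘ₗ
    comul =
      bconv (TensorProduct.mk R H H).flip (antipode R (A := H)) (antipode R (A := H)) := by
    ext k; simp [bconv_apply_repr _ _ _ (ℛ R k), ← (ℛ R k).eq]
  apply WithConv.ext
  rw [← bconv_mul_eq, ofConv_toConv, ofConv_toConv, e1, ← bconv_mk_id_id]
  rw [bconv_assoc (β₃ := LinearMap.compl₁₂ (LinearMap.mul R (H ⊗[R] H))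
      (TensorProduct.mk R H H 1) .id)
      (β₄ := LinearMap.compl₁₂ (LinearMap.mul R (H ⊗[R] H))
      ((TensorProduct.mk R H H).flip 1) .id) (by intros; simp [← mul_assoc])]
  rw [← bconv_assoc (β₁ := TensorProduct.mk R H H) (β₂ := LinearMap.mul R H)
    (β₃ := LinearMap.compl₁₂ (LinearMap.mul R (H ⊗[R] H)) ((TensorProduct.mk R H H).flip 1) .id)
    (by intros; simp), bconv_antipode_id,
    bconv_counit_left (f := TensorProduct.mk R H H 1)
      (by intros; simp [Algebra.algebraMap_eq_smul_one])]
  trans TensorProduct.mk R H H 1 ∘ₗ bconv (LinearMap.mul R H) (antipode R (A := H)) .id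
  · ext k
    simp [bconv_apply_repr _ _ _ (ℛ R k)]
  · rw [bconv_antipode_id]
    ext k
    simp [Algebra.algebraMap_eq_smul_one, Algebra.TensorProduct.one_def]

/-- The map `k ↦ ∑ β(F(k₂), Y(S(k₁) ⊗ k₃))`. -/
def wrap {M N P : Type*} [AddCommGroup M] [Module R M] [AddCommGroup N] [Module R N]
    [AddCommGroup P] [Module R P] (β : M →ₗ[R] N →ₗ[R] P) (F : H →ₗ[R] M) (Y : H ⊗[R] H →ₗ[R] N) :
    H →ₗ[R] P :=
  TensorProduct.lift (β.compl₁₂ F (Y ∘ₗ TensorProduct.map (antipode R (A := H)) .id)) ∘ₗ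
    (TensorProduct.leftComm R H H H).toLinearMap ∘ₗ comul.lTensor H ∘ₗ comul

/-- Since `S` reverses coproducts, the coproduct of `∑ S(k₁) ⊗ k₂` in the coalgebra `H ⊗ H` is `∑
(S(k₂) ⊗ k₃) ⊗ (S(k₁) ⊗ k₄)`. -/
theorem comul_comp_antipodeTmul : comul ∘ₗ antipodeTmul R H =
    TensorProduct.map (antipodeTmul R H) (TensorProduct.map (antipode R (A := H)) .id) ∘ₗ
      (TensorProduct.leftComm R H H H).toLinearMap ∘ₗ comul.lTensor H ∘ₗ comul := by
  have h1 : (comul ∘ₗ antipodeTmul R H : H →ₗ[R] (H ⊗[R] H) ⊗[R] (H ⊗[R] H)) =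
      (TensorProduct.tensorTensorTensorComm R H H H H).toLinearMap ∘ₗ
      TensorProduct.map (comul ∘ₗ (antipode R (A := H))) comul ∘ₗ comul := by
    ext k
    simp [antipodeTmul, ← (ℛ R k).eq, TensorProduct.comul_tmul,
      TensorProduct.AlgebraTensorModule.tensorTensorTensorComm_eq]
  rw [h1, comul_comp_antipode, antipodeTmul]
  simp only [coassoc_simps]

/-- Nested expressions such as `S(k₂), k₃` inside `S(k₁), k₄` are convolutions over `H ⊗ H` pulled
back along `k ↦ ∑ S(k₁) ⊗ k₂`. This lets `μ` and `ψ` be computed in the convolution algebra where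
`σ` is invertible. -/
theorem wrap_comp_antipodeTmul {M N P : Type*} [AddCommGroup M] [Module R M] [AddCommGroup N]
    [Module R N] [AddCommGroup P] [Module R P] (β : M →ₗ[R] N →ₗ[R] P) (X : H ⊗[R] H →ₗ[R] M)
    (Y : H ⊗[R] H →ₗ[R] N) :
    wrap β (X ∘ₗ antipodeTmul R H) Y = bconv β X Y ∘ₗ antipodeTmul R H := by
  rw [bconv, LinearMap.comp_assoc, comul_comp_antipodeTmul, wrap]
  simp only [← LinearMap.comp_assoc]
  congr 3
  ext
  simp

end Antipode

/-! ### Purity and evaluation -/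

section Evaluation

variable {R : Type u} [CommRing R]

/-- The canonical map `R^X ⊗ M → M^X`. -/
def piTensor (R : Type u) [CommRing R] (X : Type*) (M : Type*) [AddCommGroup M] [Module R M] :
    (X → R) ⊗[R] M →ₗ[R] (X → M) :=
  TensorProduct.lift (LinearMap.mk₂ R (fun f m x => f x • m)
    (by intros; ext; simp [add_smul]) (by intros; ext; simp [mul_smul])
    (by intros; ext; simp) (by intros; ext x; exact smul_comm _ _ _))

/-- If `∑ fᵢ ⊗ mᵢ` evaluates to zero, each vector `(fᵢ(x))ᵢ` is a relation among the `mᵢ`. The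
relation module is finitely generated, so finitely many relations, with coefficients depending on
`x`, account for all `x` at once and can be moved across the tensor sign. -/
theorem piTensor_injective [IsNoetherianRing R] (X M : Type*) [AddCommGroup M] [Module R M] :
    Function.Injective (piTensor R X M) := by
  rw [injective_iff_map_eq_zero]
  intro z hz
  obtain ⟨s, rfl⟩ := TensorProduct.exists_finset z
  let L : (s → R) →ₗ[R] M := Fintype.linearCombination R (fun i => i.1.2)
  have hmem : ∀ x, (fun i : s => i.1.1 x) ∈ LinearMap.ker L := by
    intro x
    have h0 : ∑ i ∈ s, piTensor R X M (i.1 ⊗ₜ i.2) x = 0 := by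
      rw [← Finset.sum_apply, ← map_sum, hz, Pi.zero_apply]
    rw [LinearMap.mem_ker, Fintype.linearCombination_apply, ← h0]
    exact Finset.sum_coe_sort s fun i => piTensor R X M (i.1 ⊗ₜ i.2) x
  obtain ⟨n, κ, hκ⟩ := Submodule.fg_iff_exists_fin_generating_family.1
    (IsNoetherian.noetherian (LinearMap.ker L))
  simp only [← hκ, Submodule.mem_span_range_iff_exists_fun] at hmem
  choose c hc using hmem
  -- The functions `x ↦ c x q` need no structure, because all of `R^X` is available; a choice of
  -- coefficients point by point is enough.
  have hf : ∀ i : s, i.1.1 = ∑ q, κ q i • (fun x => c x q) := by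
    intro i
    ext x
    rw [← congr_fun (hc x) i]
    simp [mul_comm]
  have hκ0 : ∀ q, ∑ i : s, κ q i • i.1.2 = 0 := by
    intro q
    have : κ q ∈ LinearMap.ker L := by
      rw [← hκ]
      exact Submodule.subset_span ⟨q, rfl⟩
    simpa [L, Fintype.linearCombination_apply] using this
  rw [← Finset.sum_coe_sort]
  calc ∑ i : s, i.1.1 ⊗ₜ[R] i.1.2
      = ∑ i : s, ∑ q, (fun x => c x q) ⊗ₜ[R] (κ q i • i.1.2) := by
        refine Finset.sum_congr rfl fun i _ => ?_
        conv_lhs => rw [hf i, TensorProduct.sum_tmul]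
        simp [TensorProduct.smul_tmul]
    _ = 0 := by
        rw [Finset.sum_comm]
        simp only [← TensorProduct.tmul_sum, hκ0, TensorProduct.tmul_zero, Finset.sum_const_zero]

variable {H : Type v} [Ring H] [HopfAlgebra R H]

theorem toFunctions_injective : Function.Injective (toFunctions R H) := by
  intro f g h
  ext k
  exact congr_fun h k

/-- The map `B ⊗ U → Hom_R(H, B)`, `b ⊗ f ↦ [k ↦ f(k) b]`. -/
def evalHom (U : LeftModuleSubalgebra R H) (B : Type*) [AddCommGroup B] [Module R B] :
    B ⊗[R] U.toNonUnitalSubalgebra →ₗ[R] (H →ₗ[R] B) :=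
  TensorProduct.lift (LinearMap.mk₂ R (fun b f => f.1.ofConv.smulRight b)
    (by intros; ext; simp) (by intros; ext; exact smul_comm _ _ _)
    (by intros; ext; simp [add_smul]) (by intros; ext; simp [mul_smul]))

@[simp]
theorem evalHom_tmul (U : LeftModuleSubalgebra R H) {B : Type*} [AddCommGroup B] [Module R B]
    (b : B) (f : U.toNonUnitalSubalgebra) (k : H) :
    evalHom U B (b ⊗ₜ f) k = f.1.ofConv k • b := rfl

theorem evalHom_injective [IsNoetherianRing R] (U : LeftModuleSubalgebra R H) {B : Type*}
    [AddCommGroup B] [Module R B] (h : IsNPure (U.toSubmodule.map (toFunctions R H)) B) :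
    Function.Injective (evalHom U B) := by
  let e : U.toNonUnitalSubalgebra ≃ₗ[R] U.toSubmodule.map (toFunctions R H) :=
    Submodule.equivMapOfInjective _ toFunctions_injective U.toSubmodule
  have key : ∀ z, ⇑(evalHom U B z) = piTensor R H B
      ((U.toSubmodule.map (toFunctions R H)).subtype.rTensor B
        (e.toLinearMap.rTensor B (TensorProduct.comm R _ _ z))) := by
    intro z
    induction z using TensorProduct.induction_on with
    | zero => simp
    | add x y hx hy => simp only [map_add, ← hx, ← hy]; rfl
    | tmul b f => rfl
  have he : Function.Injective (e.toLinearMap.rTensor B) :=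
    (LinearEquiv.rTensor B e).injective
  intro x y hxy
  have := (key x).symm.trans ((congrArg DFunLike.coe hxy).trans (key y))
  exact (TensorProduct.comm R _ _).injective (he (h (piTensor_injective _ _ this)))

theorem IsNPure.of_linearEquiv {M : Type*} [AddCommGroup M] [Module R M] {K : Submodule R M}
    {N N' : Type*} [AddCommGroup N] [Module R N] [AddCommGroup N'] [Module R N'] (e : N ≃ₗ[R] N')
    (h : IsNPure K N) : IsNPure K N' := by
  have key : K.subtype.rTensor N' = e.toLinearMap.lTensor M ∘ₗ K.subtype.rTensor N ∘ₗ
      e.symm.toLinearMap.lTensor K := by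
    ext; simp
  rw [IsNPure, key]
  exact (LinearEquiv.lTensor M e).injective.comp
    (h.comp (LinearEquiv.lTensor K e.symm).injective)

/-- Purity is transitive: up to the identifications by injective maps, `K ⊗ N → M' ⊗ N` is the
composite of two injections through `L ⊗ N`. -/
theorem IsNPure.of_submoduleOf {M : Type*} [AddCommGroup M] [Module R M] {K L : Submodule R M}
    (hle : K ≤ L) {M' : Type*} [AddCommGroup M'] [Module R M'] {f : M →ₗ[R] M'}
    (hf : Function.Injective f) {N : Type*} [AddCommGroup N] [Module R N]
    (h₁ : IsNPure (K.submoduleOf L) N) (h₂ : IsNPure (L.map f) N) : IsNPure (K.map f) N := by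
  let e₁ : K.submoduleOf L ≃ₗ[R] K := Submodule.submoduleOfEquivOfLe hle
  let e₂ : K ≃ₗ[R] K.map f := Submodule.equivMapOfInjective f hf K
  let e₃ : L ≃ₗ[R] L.map f := Submodule.equivMapOfInjective f hf L
  have key : (K.map f).subtype ∘ₗ (e₁.trans e₂).toLinearMap =
      (L.map f).subtype ∘ₗ e₃.toLinearMap ∘ₗ (K.submoduleOf L).subtype := rfl
  have inj : Function.Injective
      ((K.map f).subtype.rTensor N ∘ₗ (e₁.trans e₂).toLinearMap.rTensor N) := by
    rw [← LinearMap.rTensor_comp, key, LinearMap.rTensor_comp, LinearMap.rTensor_comp]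
    exact h₂.comp ((LinearEquiv.rTensor N e₃).injective.comp h₁)
  have surj := (LinearEquiv.rTensor N (e₁.trans e₂)).surjective
  intro x y hxy
  obtain ⟨x, rfl⟩ := surj x
  obtain ⟨y, rfl⟩ := surj y
  exact congrArg _ (inj hxy)

/-- Purity is assumed against modules of one fixed universe, so it is applied to a lift of `A ⊗ H`
to that universe and transported back. -/
theorem isNPure_of_isSubbialgebra [IsNoetherianRing R] {A : Type w} [Ring A] [Algebra R A]
    {U : LeftModuleSubalgebra R H} (hH : IsHopfAlphaAlgebra.{u, v, max u v w} R H)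
    (hU : IsSubbialgebra.{u, v, max u v w} U) :
    IsNPure (U.toSubmodule.map (toFunctions R H)) (A ⊗[R] H) :=
  IsNPure.of_linearEquiv (ULift.moduleEquiv : ULift.{max u v w} (A ⊗[R] H) ≃ₗ[R] A ⊗[R] H)
    (IsNPure.of_submoduleOf hU.le toFunctions_injective (hU.pure _) (hH _))

end Evaluation

/-! ### The representation of an opposite smash product -/

section Representation

variable {R : Type u} {H : Type v} [CommRing R] [Ring H] [HopfAlgebra R H]
variable {B : Type x} [NonUnitalNonAssocRing B] [Module R B]

/-- The map `b ↦ ∑ b₍₀₎ f(b₍₁₎)`. -/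
def hit (ρ : B →ₗ[R] B ⊗[R] H) : ConvDual R H →ₗ[R] B →ₗ[R] B :=
  LinearMap.mk₂ R
    (fun f b => TensorProduct.rid R B (f.ofConv.lTensor B (ρ b)))
    (by intros; simp [LinearMap.lTensor_add]) (by intros; simp [LinearMap.lTensor_smul])
    (by intros; simp) (by intros; simp)

theorem hit_apply (ρ : B →ₗ[R] B ⊗[R] H) (f : ConvDual R H) (b : B) :
    hit ρ f b = TensorProduct.rid R B (f.ofConv.lTensor B (ρ b)) := rfl

theorem hit_mul {ρ : B →ₗ[R] B ⊗[R] H}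
    (hρ : (TensorProduct.assoc R B H H).toLinearMap ∘ₗ ρ.rTensor H ∘ₗ ρ = comul.lTensor B ∘ₗ ρ)
    (f g : ConvDual R H) (b : B) : hit ρ (f * g) b = hit ρ f (hit ρ g b) := by
  have key := congr((TensorProduct.rid R B) ((LinearMap.mul' R R ∘ₗ
    TensorProduct.map f.ofConv g.ofConv).lTensor B ($hρ b)))
  have h1 : hit ρ (f * g) b = (TensorProduct.rid R B) ((LinearMap.mul' R R ∘ₗ
      TensorProduct.map f.ofConv g.ofConv).lTensor B (comul.lTensor B (ρ b))) := by
    rw [hit_apply, ← LinearMap.lTensor_comp_apply]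
    rfl
  rw [h1]
  refine key.symm.trans ?_
  simp only [LinearMap.comp_apply]
  rw [hit_apply ρ g]
  induction ρ b using TensorProduct.induction_on with
  | zero => simp
  | add x y hx hy => simp only [map_add, hx, hy]
  | tmul x k =>
    simp only [LinearMap.rTensor_tmul, LinearMap.lTensor_tmul, TensorProduct.rid_tmul, map_smul,
      hit_apply]
    induction ρ x using TensorProduct.induction_on with
    | zero => simp
    | add x y hx hy => simp only [map_add, TensorProduct.add_tmul, hx, hy, smul_add]
    | tmul y l => simpa [mul_smul] using smul_comm _ _ _

variable [IsScalarTower R B B] [SMulCommClass R B B]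

/-- The map `B #^op U → End_R(B)`, `b # f ↦ [c ↦ ∑ c₍₀₎ f(c₍₁₎) b]`. -/
def opRep (ρ : B →ₗ[R] B ⊗[R] H) (U : LeftModuleSubalgebra R H) :
    B ⊗[R] U.toNonUnitalSubalgebra →ₗ[R] (B →ₗ[R] B) :=
  TensorProduct.lift (LinearMap.mk₂ R
    (fun b f => LinearMap.mulRight R b ∘ₗ hit ρ f.1)
    (by intros; ext; simp [mul_add]) (by intros; ext; simp [mul_smul_comm])
    (by intros; ext; simp [add_mul]) (by intros; ext; simp))

@[simp]
theorem opRep_tmul (ρ : B →ₗ[R] B ⊗[R] H) (U : LeftModuleSubalgebra R H) (b : B)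
    (f : U.toNonUnitalSubalgebra) (c : B) : opRep ρ U (b ⊗ₜ f) c = hit ρ f.1 c * b := rfl

/-- Because `f(c₍₁₎ b₍₁₎) = (b₍₁₎ f)(c₍₁₎)`, moving `f` past a product produces the left regular
action that occurs in the smash multiplication. -/
theorem hit_apply_mul {ρ : B →ₗ[R] B ⊗[R] H} (hρ : ∀ x y, ρ (x * y) = ρ x * ρ y)
    (f : ConvDual R H) (b c : B) : hit ρ f (c * b) =
      TensorProduct.lift (LinearMap.mk₂ R (fun y h => hit ρ (leftRegular h f) c * y)
        (by intros; simp [mul_add]) (by intros; simp [mul_smul_comm])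
        (by intros; simp [add_mul]) (by intros; simp [smul_mul_assoc])) (ρ b) := by
  rw [hit_apply, hρ]
  induction ρ b using TensorProduct.induction_on with
  | zero => simp
  | add x y hx hy => simp only [mul_add, map_add, hx, hy]
  | tmul y h =>
    simp only [TensorProduct.lift.tmul, LinearMap.mk₂_apply, hit_apply]
    induction ρ c using TensorProduct.induction_on with
    | zero => simp
    | add x y hx hy => simp only [map_add, add_mul, hx, hy]
    | tmul x k => simp [leftRegular, smul_mul_assoc]

/-- `opRep` is multiplicative for the opposite of the composition. -/
theorem opRep_mul {ρ : B →ₗ[R] B ⊗[R] H} (hB : ∀ x y z : B, x * y * z = x * (y * z))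
    (hρ : (TensorProduct.assoc R B H H).toLinearMap ∘ₗ ρ.rTensor H ∘ₗ ρ = comul.lTensor B ∘ₗ ρ)
    (hρm : ∀ x y, ρ (x * y) = ρ x * ρ y) (U : LeftModuleSubalgebra R H) 
    (x y : B ⊗[R] U.toNonUnitalSubalgebra) :
    opRep ρ U (opMul ρ U x y) = opRep ρ U y ∘ₗ opRep ρ U x := by
  induction x using TensorProduct.induction_on with
  | zero => simp
  | add x₁ x₂ h₁ h₂ => simp only [map_add, LinearMap.add_apply, h₁, h₂, LinearMap.comp_add]
  | tmul b f =>
    induction y using TensorProduct.induction_on with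
    | zero => simp
    | add y₁ y₂ h₁ h₂ => simp only [map_add, h₁, h₂, LinearMap.add_comp]
    | tmul b' f' =>
      ext c
      simp only [LinearMap.comp_apply, opRep_tmul, hit_apply_mul hρm, opMul,
        TensorProduct.lift.tmul,
        LinearMap.mk₂_apply]
      induction ρ b using TensorProduct.induction_on with
      | zero => simp
      | add x₁ x₂ h₁ h₂ => simp only [map_add, LinearMap.add_apply, h₁, h₂, add_mul]
      | tmul b₀ h =>
        simp [opMulAux, LeftModuleSubalgebra.act, hit_mul hρ, hB]

end Representation

/-! ### The multiplication of a crossed product -/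

section CrossedMul

variable {R : Type u} {H : Type v} {A : Type w}
variable [CommRing R] [Ring H] [HopfAlgebra R H] [Ring A] [Algebra R A]

/-- Scalar multiplication `A × (A ⊗ M) → A ⊗ M` as a bilinear map. -/
def leftSMul (R : Type u) (A : Type w) [CommRing R] [Ring A] [Algebra R A] (M : Type*)
    [AddCommGroup M] [Module R M] : A →ₗ[R] A ⊗[R] M →ₗ[R] A ⊗[R] M :=
  (Algebra.lsmul R R (A ⊗[R] M)).toLinearMap

@[simp]
theorem leftSMul_apply {M : Type*} [AddCommGroup M] [Module R M] (a : A) (x : A ⊗[R] M) :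
    leftSMul R A M a x = a • x := rfl

theorem cocycleMul_eq_bconv (σ : H ⊗[R] H →ₗ[R] A) :
    cocycleMul σ = bconv (TensorProduct.mk R A H) σ (LinearMap.mul' R H) := by
  ext x
  simp [cocycleMul, bconv_apply_repr _ _ _ (ℛ R _), ← (ℛ R (_ : H ⊗[R] H)).eq]

theorem cocycleMul_tmul (σ : H ⊗[R] H →ₗ[R] A) {h k : H} {ι κ : Type*}
    (r : Coalgebra.Repr R h ι) (s : Coalgebra.Repr R k κ) :
    cocycleMul σ (h ⊗ₜ k) = ∑ i ∈ r.index, ∑ j ∈ s.index,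
      σ (r.left i ⊗ₜ s.left j) ⊗ₜ (r.right i * s.right j) := by
  rw [Finset.sum_comm]
  simp [cocycleMul, TensorProduct.comul_tmul, ← r.eq, ← s.eq, TensorProduct.sum_tmul,
    TensorProduct.tmul_sum, TensorProduct.AlgebraTensorModule.tensorTensorTensorComm_eq]

variable (ω : WeakAction R H A) (σ : H ⊗[R] H →ₗ[R] A)

theorem crossedMul_tmul_tmul (a a' : A) (h k : H) {ι : Type*} (r : Coalgebra.Repr R h ι) :
    crossedMul ω σ (a ⊗ₜ h) (a' ⊗ₜ k) = ∑ i ∈ r.index,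
      (a * ω.act (r.left i) a') • cocycleMul σ (r.right i ⊗ₜ k) := by
  simp [crossedMul, crossedMulAux, ← r.eq, mul_smul]

/-- The first coefficient only ever acts by left multiplication. Identities for `(a # h) x`
therefore reduce to `a = 1`, where the product is a convolution in `h`. -/
theorem crossedMul_smul (a : A) (x y : A ⊗[R] H) :
    crossedMul ω σ (a • x) y = a • crossedMul ω σ x y := by
  induction x using TensorProduct.induction_on with
  | zero => simp
  | add x₁ x₂ h₁ h₂ => simp only [smul_add, map_add, LinearMap.add_apply, h₁, h₂]
  | tmul b h =>
    induction y using TensorProduct.induction_on with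
    | zero => simp
    | add y₁ y₂ h₁ h₂ => simp only [smul_add, map_add, h₁, h₂]
    | tmul c k =>
      rw [TensorProduct.smul_tmul', crossedMul_tmul_tmul _ _ _ _ _ _ (ℛ R h),
        crossedMul_tmul_tmul _ _ _ _ _ _ (ℛ R h)]
      simp [Finset.smul_sum, smul_smul, mul_assoc]

/-- The left multiplication by `1 # p`, as a function of `p`. -/
theorem crossedMul_one_tmul (a : A) (k : H) :
    (crossedMul ω σ ∘ₗ TensorProduct.mk R A H 1).flip (a ⊗ₜ k) =
      bconv (leftSMul R A H) (ω.act.flip a) (cocycleMul σ ∘ₗ (TensorProduct.mk R H H).flip k) := by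
  ext p
  simp [crossedMul_tmul_tmul _ _ _ _ _ _ (ℛ R p), bconv_apply_repr _ _ _ (ℛ R p)]

theorem act_one (h : H) : ω.act h 1 = counit (R := R) h • (1 : A) := by
  have := congr($(ω.conv_one).ofConv h)
  simpa [Algebra.algebraMap_eq_smul_one] using this

theorem crossedMul_one_tmul_one_tmul (p k : H) :
    crossedMul ω σ (1 ⊗ₜ p) (1 ⊗ₜ k) = cocycleMul σ (p ⊗ₜ k) := by
  have := congr($(crossedMul_one_tmul ω σ 1 k) p)
  rw [bconv_counit_left (f := .id) (by intros; simp [act_one])] at this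
  simpa using this

theorem cocycleMul_comp_mk_flip (k : H) {ι : Type*} (r : Coalgebra.Repr R k ι) :
    cocycleMul σ ∘ₗ (TensorProduct.mk R H H).flip k =
      ∑ i ∈ r.index, bconv (TensorProduct.mk R A H) (σ ∘ₗ (TensorProduct.mk R H H).flip (r.left i))
        (LinearMap.mulRight R (r.right i)) := by
  ext p
  simp only [LinearMap.comp_apply, LinearMap.flip_apply, TensorProduct.mk_apply,
    cocycleMul_tmul σ (ℛ R p) r, LinearMap.sum_apply, bconv_apply_repr _ _ _ (ℛ R p)]
  rw [Finset.sum_comm]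
  simp

theorem phi_eq_bconv (h : H) (a : A) :
    phi ω σ h a = bconv (LinearMap.mul R A) (ω.act.flip a)
      (σ ∘ₗ (TensorProduct.mk R H H).flip h) := by
  ext p
  simp [phi, bconv_apply_repr _ _ _ (ℛ R p), ← (ℛ R p).eq]

/-- `(1 # p)(a # k) = ∑ φ(k₁ ⊗ a)(p₁) # p₂ k₂`. -/
theorem crossedMul_one_tmul_eq_sum_phi (a : A) (k : H) {ι : Type*} (r : Coalgebra.Repr R k ι) :
    (crossedMul ω σ ∘ₗ TensorProduct.mk R A H 1).flip (a ⊗ₜ k) =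
      ∑ i ∈ r.index, bconv (TensorProduct.mk R A H) (phi ω σ (r.left i) a)
        (LinearMap.mulRight R (r.right i)) := by
  rw [crossedMul_one_tmul, cocycleMul_comp_mk_flip σ k r, ← bconvₗ_apply, map_sum]
  refine Finset.sum_congr rfl fun i _ => ?_
  rw [bconvₗ_apply, phi_eq_bconv, bconv_assoc (β₃ := leftSMul R A H)
    (β₄ := (TensorProduct.mk R A H))]
  simp [TensorProduct.smul_tmul']

/-! ### The comodule algebra structure -/

/-- `cocycleMul σ` is the convolution of `σ` with the multiplication of `H`, and `Δ` after
multiplication is the convolution of the multiplication with itself; reassociating gives the claim.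
-/
theorem coaction_cocycleMul (h k : H) {ι κ : Type*}
    (r : Coalgebra.Repr R h ι) (s : Coalgebra.Repr R k κ) :
    (TensorProduct.assoc R A H H).symm (comul.lTensor A (cocycleMul σ (h ⊗ₜ k))) =
      ∑ i ∈ r.index, ∑ j ∈ s.index,
        cocycleMul σ (r.left i ⊗ₜ s.left j) ⊗ₜ (r.right i * s.right j) := by
  have h1 : comul.lTensor A ∘ₗ cocycleMul σ = bconv ((TensorProduct.mk R A (H ⊗[R] H)))
      σ (comul ∘ₗ LinearMap.mul' R H) := by
    rw [cocycleMul_eq_bconv, comp_bconv]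
    rfl
  have h2 : comul ∘ₗ LinearMap.mul' R H = bconv (TensorProduct.mk R H H) (LinearMap.mul' R H)
      (LinearMap.mul' R H) := by
    ext x y
    simp only [TensorProduct.AlgebraTensorModule.curry_apply, LinearMap.restrictScalars_self,
      TensorProduct.curry_apply, LinearMap.comp_apply, LinearMap.mul'_apply, Bialgebra.comul_mul]
    rw [← (ℛ R x).eq, ← (ℛ R y).eq, Finset.sum_mul_sum, Finset.sum_comm]
    simp [bconv, TensorProduct.comul_tmul, ← (ℛ R x).eq, ← (ℛ R y).eq, TensorProduct.sum_tmul,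
      TensorProduct.tmul_sum,
      TensorProduct.AlgebraTensorModule.tensorTensorTensorComm_eq]
  have h3 : (TensorProduct.assoc R A H H).symm.toLinearMap ∘ₗ comul.lTensor A ∘ₗ cocycleMul σ =
      bconv (TensorProduct.mk R (A ⊗[R] H) H) (cocycleMul σ) (LinearMap.mul' R H) := by
    rw [h1, h2, comp_bconv, cocycleMul_eq_bconv]
    symm
    apply bconv_assoc
    intros; rfl
  refine congr($h3 (h ⊗ₜ k)).trans ?_
  rw [Finset.sum_comm]
  simp [bconv, TensorProduct.comul_tmul, ← r.eq, ← s.eq, TensorProduct.sum_tmul,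
    TensorProduct.tmul_sum, TensorProduct.AlgebraTensorModule.tensorTensorTensorComm_eq]

theorem coaction_coassoc :
    (TensorProduct.assoc R (CrossedProduct ω σ) H H).toLinearMap ∘ₗ
        (CrossedProduct.coaction ω σ).rTensor H ∘ₗ CrossedProduct.coaction ω σ =
      comul.lTensor (CrossedProduct ω σ) ∘ₗ CrossedProduct.coaction ω σ := by
  refine TensorProduct.ext' (M := A) (N := H) fun a h => ?_
  let φ : H ⊗[R] (H ⊗[R] H) →ₗ[R] (A ⊗[R] H) ⊗[R] (H ⊗[R] H) := (TensorProduct.mk R A H a).rTensor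
    (H ⊗[R] H)
  have key := congr(φ $(coassoc_apply (R := R) h))
  have h1 : ∀ z : H ⊗[R] H, TensorProduct.assoc R (A ⊗[R] H) H H
      (((TensorProduct.assoc R A H H).symm.toLinearMap ∘ₗ comul.lTensor A).rTensor H
        ((TensorProduct.assoc R A H H).symm (a ⊗ₜ z))) =
      φ (TensorProduct.assoc R H H H (comul.rTensor H z)) := by
    intro z
    induction z using TensorProduct.induction_on with
    | zero => simp
    | add x y hx hy => simp only [map_add, TensorProduct.tmul_add, hx, hy]
    | tmul x y =>
      simp only [TensorProduct.assoc_symm_tmul, LinearMap.rTensor_tmul, LinearMap.comp_apply,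
        LinearMap.lTensor_tmul, LinearEquiv.coe_coe]
      induction comul (R := R) x using TensorProduct.induction_on with
      | zero => simp
      | add x y hx hy => simp only [map_add, TensorProduct.tmul_add, TensorProduct.add_tmul, hx, hy]
      | tmul x y => simp [φ]
  have h2 : ∀ z : H ⊗[R] H, comul.lTensor (A ⊗[R] H)
      ((TensorProduct.assoc R A H H).symm (a ⊗ₜ z)) = φ (comul.lTensor H z) := by
    intro z
    induction z using TensorProduct.induction_on with
    | zero => simp
    | add x y hx hy => simp only [map_add, TensorProduct.tmul_add, hx, hy]
    | tmul x y => simp [φ]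
  exact ((h1 _).trans key).trans (h2 _).symm

theorem coaction_mk (a : A) (h : H) {ι : Type*} (r : Coalgebra.Repr R h ι) :
    CrossedProduct.coaction ω σ (CrossedProduct.mk ω σ a h) =
      ∑ i ∈ r.index, CrossedProduct.mk ω σ a (r.left i) ⊗ₜ[R] r.right i := by
  change (TensorProduct.assoc R A H H).symm (comul.lTensor A (a ⊗ₜ h)) = _
  rw [LinearMap.lTensor_tmul, ← r.eq, TensorProduct.tmul_sum, map_sum]
  rfl

theorem coaction_smul (a : A) (x : A ⊗[R] H) :
    (TensorProduct.assoc R A H H).symm (comul.lTensor A (a • x)) =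
      a • (TensorProduct.assoc R A H H).symm (comul.lTensor A x) := by
  induction x using TensorProduct.induction_on with
  | zero => simp
  | add x y hx hy => simp only [smul_add, map_add, hx, hy]
  | tmul b h =>
    simp only [TensorProduct.smul_tmul', LinearMap.lTensor_tmul]
    induction comul (R := R) h using TensorProduct.induction_on with
    | zero => simp
    | add x y hx hy => simp only [TensorProduct.tmul_add, map_add, hx, hy, smul_add]
    | tmul x y => simp [TensorProduct.smul_tmul']

theorem coaction_comp_crossedMul_one_tmul (b : A) (k : H) {ι : Type*}
    (s : Coalgebra.Repr R k ι) :
    ((TensorProduct.assoc R A H H).symm.toLinearMap ∘ₗ comul.lTensor A) ∘ₗ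
        (crossedMul ω σ ∘ₗ TensorProduct.mk R A H 1).flip (b ⊗ₜ k) =
      ∑ j ∈ s.index, bconv (TensorProduct.mk R (A ⊗[R] H) H)
        ((crossedMul ω σ ∘ₗ TensorProduct.mk R A H 1).flip (b ⊗ₜ s.left j))
          (LinearMap.mulRight R (s.right j)) := by
  let Λ : A →ₗ[R] (A ⊗[R] H) ⊗[R] H →ₗ[R] (A ⊗[R] H) ⊗[R] H :=
    (Algebra.lsmul R R ((A ⊗[R] H) ⊗[R] H)).toLinearMap
  have h1 : ((TensorProduct.assoc R A H H).symm.toLinearMap ∘ₗ comul.lTensor A) ∘ₗ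
      cocycleMul σ ∘ₗ (TensorProduct.mk R H H).flip k =
      ∑ j ∈ s.index, bconv (TensorProduct.mk R (A ⊗[R] H) H)
        (cocycleMul σ ∘ₗ (TensorProduct.mk R H H).flip (s.left j))
        (LinearMap.mulRight R (s.right j)) := by
    ext p
    simp only [LinearMap.comp_apply, LinearMap.flip_apply, TensorProduct.mk_apply,
      LinearEquiv.coe_coe, coaction_cocycleMul σ p k (ℛ R p) s, LinearMap.sum_apply,
      bconv_apply_repr _ _ _ (ℛ R p)]
    rw [Finset.sum_comm]
    rfl
  have h2 : ((TensorProduct.assoc R A H H).symm.toLinearMap ∘ₗ comul.lTensor A) ∘ₗ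
      (crossedMul ω σ ∘ₗ TensorProduct.mk R A H 1).flip (b ⊗ₜ k) = bconv Λ (ω.act.flip b)
        (((TensorProduct.assoc R A H H).symm.toLinearMap ∘ₗ comul.lTensor A) ∘ₗ
          cocycleMul σ ∘ₗ (TensorProduct.mk R H H).flip k) := by
    rw [crossedMul_one_tmul, comp_bconv]
    ext p
    simp [bconv_apply_repr _ _ _ (ℛ R p), coaction_smul, Λ]
  rw [h2, h1, ← bconvₗ_apply, map_sum]
  refine Finset.sum_congr rfl fun j _ => ?_
  rw [bconvₗ_apply, crossedMul_one_tmul]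
  symm
  apply bconv_assoc
  intros
  rfl

theorem coaction_mul (x y : CrossedProduct ω σ) : CrossedProduct.coaction ω σ (x * y) =
    CrossedProduct.coaction ω σ x * CrossedProduct.coaction ω σ y := by
  suffices h : ((LinearMap.mul R (CrossedProduct ω σ)).compr₂ (CrossedProduct.coaction ω σ)) =
      (LinearMap.mul R (CrossedProduct ω σ ⊗[R] H)).compl₁₂
        (CrossedProduct.coaction ω σ) (CrossedProduct.coaction ω σ) from
    congr($h x y)
  refine TensorProduct.ext' (M := A) (N := H) fun a h => ?_
  refine TensorProduct.ext' (M := A) (N := H) fun b k => ?_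
  have ha : (a ⊗ₜ[R] h : A ⊗[R] H) = a • ((1 : A) ⊗ₜ[R] h) := by simp [TensorProduct.smul_tmul']
  have h1 := congr($(coaction_comp_crossedMul_one_tmul ω σ b k (ℛ R k)) h)
  simp only [LinearMap.comp_apply, LinearMap.flip_apply, TensorProduct.mk_apply,
      LinearEquiv.coe_coe, LinearMap.sum_apply, bconv_apply_repr _ _ _ (ℛ R h)] at h1
  change (TensorProduct.assoc R A H H).symm (comul.lTensor A
    (crossedMul ω σ (a ⊗ₜ h) (b ⊗ₜ k))) = CrossedProduct.coaction ω σ (CrossedProduct.mk ω σ a h) *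
      CrossedProduct.coaction ω σ (CrossedProduct.mk ω σ b k)
  rw [ha, crossedMul_smul, coaction_smul, h1, coaction_mk ω σ a h (ℛ R h),
    coaction_mk ω σ b k (ℛ R k), Finset.sum_mul_sum, Finset.sum_comm, Finset.smul_sum]
  simp only [Finset.smul_sum]
  refine Finset.sum_congr rfl fun i _ => Finset.sum_congr rfl fun j _ => ?_
  rw [Algebra.TensorProduct.tmul_mul_tmul]
  change (a • crossedMul ω σ (1 ⊗ₜ (ℛ R h).left i) (b ⊗ₜ (ℛ R k).left j)) ⊗ₜ[R] _ =
    crossedMul ω σ (a ⊗ₜ (ℛ R h).left i) (b ⊗ₜ (ℛ R k).left j) ⊗ₜ[R] _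
  rw [← crossedMul_smul]
  simp [TensorProduct.smul_tmul']

end CrossedMul

/-! ### The convolution inverse of `k ↦ 1 # k` -/

section Wrap

variable {R : Type u} {H : Type v} [CommRing R] [Ring H] [HopfAlgebra R H]
  {M N P Q : Type*} [AddCommGroup M] [Module R M] [AddCommGroup N] [Module R N]
  [AddCommGroup P] [Module R P] [AddCommGroup Q] [Module R Q]

theorem wrap_eq_bconv {β : M →ₗ[R] N →ₗ[R] P} {β₃ : H →ₗ[R] Q →ₗ[R] P}
    {β₄ : M →ₗ[R] H →ₗ[R] Q} {Y : H ⊗[R] H →ₗ[R] N}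
    (h : ∀ x p k, β x (Y ((antipode R (A := H)) p ⊗ₜ k)) = β₃ p (β₄ x k)) (F : H →ₗ[R] M) :
    wrap β F Y = bconv β₃ .id (bconv β₄ F .id) := by
  have h1 : bconv β₃ .id (bconv β₄ F .id) = TensorProduct.lift (β₃.compl₁₂ .id
      (TensorProduct.lift (β₄.compl₁₂ F .id))) ∘ₗ comul.lTensor H ∘ₗ comul := by
    rw [← LinearMap.comp_assoc, bconv]
    congr 1
    ext
    simp [bconv]
  rw [h1, wrap, ← LinearMap.comp_assoc]
  congr 1
  ext
  simp [h]

end Wrap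

/-! ### A left inverse of `γ(k) = 1 # k`, and why it is two-sided -/

section Inverse

variable {R : Type u} {H : Type v} {A : Type w}
variable [CommRing R] [Ring H] [HopfAlgebra R H] [Ring A] [Algebra R A]

/-- The map `k ↦ ∑ σ⁻¹(S(k₂) ⊗ k₃) # S(k₁)`. -/
def gammaInv (σinv : H ⊗[R] H →ₗ[R] A) : H →ₗ[R] A ⊗[R] H :=
  bconv (TensorProduct.mk R A H).flip (antipode R) (σinv ∘ₗ antipodeTmul R H)

variable (ω : WeakAction R H A) (σ σinv : H ⊗[R] H →ₗ[R] A)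

/-- Pulling `σ⁻¹` out by left `A`-linearity leaves `∑ σ⁻¹(S(k₂) ⊗ k₃) · (1 # S(k₁)) D(k₄)`, the
pullback of a convolution over `H ⊗ H` with `σ⁻¹` as its left factor, ready to be cancelled against
`σ`. -/
theorem bconv_gammaInv (D : H →ₗ[R] A ⊗[R] H) :
    bconv (crossedMul ω σ) (gammaInv σinv) D = bconv (leftSMul R A H) σinv
      (TensorProduct.lift ((crossedMul ω σ ∘ₗ TensorProduct.mk R A H 1).compl₂ D)) ∘ₗ
        antipodeTmul R H := by
  let β₃ : H →ₗ[R] A ⊗[R] (A ⊗[R] H) →ₗ[R] A ⊗[R] H :=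
    LinearMap.mk₂ R (fun h z => TensorProduct.lift
      ((leftSMul R A H).compl₂ (crossedMul ω σ (1 ⊗ₜ h))) z)
      (by
        intro h h' z
        induction z using TensorProduct.induction_on with
        | zero => simp
        | add x y hx hy => simp only [map_add, hx, hy]; abel
        | tmul a x => simp [TensorProduct.tmul_add])
      (by
        intro c h z
        induction z using TensorProduct.induction_on with
        | zero => simp
        | add x y hx hy => simp only [map_add, hx, hy, smul_add]
        | tmul a x => simp)
      (by intros; simp) (by intros; simp)
  rw [← wrap_comp_antipodeTmul, wrap_eq_bconv (β₃ := β₃ ∘ₗ (antipode R (A := H)))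
    (β₄ := (TensorProduct.mk R A (A ⊗[R] H)).compl₂ D) (by intros; simp [β₃]), gammaInv,
    bconv_assoc (β₃ := β₃) (β₄ := TensorProduct.mk R A (A ⊗[R] H))]
  · rfl
  · intro h a x
    have : (a ⊗ₜ[R] h : A ⊗[R] H) = a • ((1 : A) ⊗ₜ[R] h) := by simp [TensorProduct.smul_tmul']
    simp [β₃, this, crossedMul_smul]

theorem bconv_leftSMul_bconv_mk {C M : Type*} [AddCommGroup C] [Module R C] [Coalgebra R C]
    [AddCommGroup M] [Module R M] (X Y : C →ₗ[R] A) (Z : C →ₗ[R] M) :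
    bconv (leftSMul R A M) X (bconv (TensorProduct.mk R A M) Y Z) =
      bconv (TensorProduct.mk R A M) (bconv (LinearMap.mul R A) X Y) Z := by
  symm
  apply bconv_assoc
  intros
  simp [TensorProduct.smul_tmul']

theorem bconv_leftSMul_assoc {C M : Type*} [AddCommGroup C] [Module R C] [Coalgebra R C]
    [AddCommGroup M] [Module R M] (X Y : C →ₗ[R] A) (Z : C →ₗ[R] A ⊗[R] M) :
    bconv (leftSMul R A M) X (bconv (leftSMul R A M) Y Z) =
      bconv (leftSMul R A M) (bconv (LinearMap.mul R A) X Y) Z := by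
  symm
  apply bconv_assoc
  intros
  simp [mul_smul]

theorem mul_comp_antipodeTmul :
    LinearMap.mul' R H ∘ₗ antipodeTmul R H = Algebra.linearMap R H ∘ₗ counit := by
  rw [← bconv_antipode_id]
  ext k
  simp [antipodeTmul, bconv_apply_repr _ _ _ (ℛ R k), ← (ℛ R k).eq]

variable {σ σinv}

/-- For `D = γ` the second factor is `σ` convolved with multiplication. Cancelling `σ⁻¹` with `σ`
leaves `∑ S(k₁) k₂ = ε(k) 1`. Associativity of the crossed product plays no role here. -/
theorem gammaInv_bconv_gamma
    (h : bconv (LinearMap.mul R A) σinv σ = Algebra.linearMap R A ∘ₗ counit) :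
    bconv (crossedMul ω σ) (gammaInv σinv) (TensorProduct.mk R A H 1) =
      counit.smulRight (1 ⊗ₜ 1) := by
  have h1 : TensorProduct.lift ((crossedMul ω σ ∘ₗ TensorProduct.mk R A H 1).compl₂
    (TensorProduct.mk R A H 1)) = cocycleMul σ := by
    ext p k
    simp [crossedMul_one_tmul_one_tmul]
  rw [bconv_gammaInv, h1, cocycleMul_eq_bconv, bconv_leftSMul_bconv_mk, h,
    bconv_counit_left (f := TensorProduct.mk R A H 1), LinearMap.comp_assoc, mul_comp_antipodeTmul]
  · ext k
    simp [Algebra.algebraMap_eq_smul_one]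
  · intros
    simp [Algebra.algebraMap_eq_smul_one, TensorProduct.smul_tmul']

/-- The map `a ⊗ c ↦ ∑ a X(c₁) ⊗ c₂`. -/
def twist {C : Type*} [AddCommGroup C] [Module R C] [Coalgebra R C] (X : C →ₗ[R] A) :
    A ⊗[R] C →ₗ[R] A ⊗[R] C :=
  TensorProduct.lift ((leftSMul R A C).compl₂ (bconv (TensorProduct.mk R A C) X .id))

theorem twist_twist {C : Type*} [AddCommGroup C] [Module R C] [Coalgebra R C]
    {X Y : C →ₗ[R] A} (h : bconv (LinearMap.mul R A) X Y = Algebra.linearMap R A ∘ₗ counit)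
    (z : A ⊗[R] C) : twist Y (twist X z) = z := by
  have key : twist Y ∘ₗ bconv (TensorProduct.mk R A C) X .id = TensorProduct.mk R A C 1 := by
    have : twist Y ∘ₗ bconv (TensorProduct.mk R A C) X .id =
        bconv (leftSMul R A C) X (bconv (TensorProduct.mk R A C) Y .id) := by
      rw [comp_bconv]
      rfl
    rw [this, bconv_leftSMul_bconv_mk, h, bconv_counit_left (f := TensorProduct.mk R A C 1)
      (by intros; simp [Algebra.algebraMap_eq_smul_one, TensorProduct.smul_tmul'])]
    rfl
  have hs : ∀ (a : A) z, twist Y (a • z) = a • twist Y z := by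
    intro a z
    induction z using TensorProduct.induction_on with
    | zero => simp
    | add x y hx hy => simp only [smul_add, map_add, hx, hy]
    | tmul b c => simp [twist, TensorProduct.smul_tmul', mul_smul]
  induction z using TensorProduct.induction_on with
  | zero => simp
  | add x y hx hy => simp only [map_add, hx, hy]
  | tmul a c =>
    have := congr($key c)
    rw [LinearMap.comp_apply] at this
    conv_lhs => enter [2]; simp only [twist, TensorProduct.lift.tmul, LinearMap.compl₂_apply]
    rw [leftSMul_apply, hs, this]
    simp [TensorProduct.smul_tmul']

/-- The map `h ⊗ l ↦ ∑ h l₁ ⊗ l₂`. -/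
def galois (R : Type u) (H : Type v) [CommRing R] [Ring H] [HopfAlgebra R H] :
    H ⊗[R] H →ₗ[R] H ⊗[R] H :=
  (LinearMap.mul' R H).rTensor H ∘ₗ (TensorProduct.assoc R H H H).symm.toLinearMap ∘ₗ
    comul.lTensor H

/-- The inverse is `h ⊗ l ↦ ∑ h S(l₁) ⊗ l₂`. A linear left inverse, unlike mere injectivity,
survives tensoring with `A`. -/
theorem galois_leftInverse :
    ∃ g : H ⊗[R] H →ₗ[R] H ⊗[R] H, g ∘ₗ galois R H = .id := by
  let G : H ⊗[R] H →ₗ[R] H ⊗[R] H := (LinearMap.mul' R H).rTensor H ∘ₗ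
    (TensorProduct.assoc R H H H).symm.toLinearMap ∘ₗ
    (TensorProduct.map (antipode R (A := H)) .id ∘ₗ comul).lTensor H
  have hG : ∀ h l, G (h ⊗ₜ l) = (LinearMap.mulLeft R h).rTensor H
      (bconv (TensorProduct.mk R H H) (antipode R (A := H)) .id l) := by
    intro h l
    simp [G, bconv_apply_repr _ _ _ (ℛ R l), ← (ℛ R l).eq, TensorProduct.tmul_sum]
  refine ⟨G, LinearMap.ext fun z => ?_⟩
  rw [LinearMap.comp_apply, LinearMap.id_apply]
  induction z using TensorProduct.induction_on with
  | zero => simp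
  | add x y hx hy => simp only [map_add, hx, hy]
  | tmul h l =>
    have key : bconv (((LinearMap.mul R (H ⊗[R] H)).flip.compl₁₂ .id
        ((TensorProduct.mk R H H).flip 1)).flip) LinearMap.id
        (bconv (TensorProduct.mk R H H) (antipode R (A := H)) .id) = TensorProduct.mk R H H 1 := by
      rw [← bconv_assoc (β₁ := TensorProduct.mk R H H) (β₂ := LinearMap.mul R H)
        (by intros; simp), bconv_id_antipode, bconv_counit_left (f := TensorProduct.mk R H H 1)
          (by intros; simp [Algebra.algebraMap_eq_smul_one])]
      rfl
    have := congr((LinearMap.mulLeft R h).rTensor H ($key l))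
    simp only [LinearMap.rTensor_tmul, TensorProduct.mk_apply, LinearMap.mulLeft_apply,
      mul_one] at this
    refine Eq.trans ?_ this
    rw [bconv_apply_repr _ _ _ (ℛ R l)]
    simp only [galois, LinearMap.comp_apply, LinearMap.lTensor_tmul, LinearEquiv.coe_coe]
    rw [← (ℛ R l).eq]
    simp only [TensorProduct.tmul_sum, map_sum, TensorProduct.assoc_symm_tmul,
      LinearMap.rTensor_tmul, LinearMap.mul'_apply, hG]
    refine Finset.sum_congr rfl fun i _ => ?_
    generalize bconv (TensorProduct.mk R H H) (antipode R (A := H)) .id ((ℛ R l).right i) = z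
    induction z using TensorProduct.induction_on with
    | zero => simp
    | add x y hx hy => simp only [map_add, hx, hy]
    | tmul x y => simp

theorem bconv_comp_mk {M N P : Type*} [AddCommGroup M] [Module R M] [AddCommGroup N] [Module R N]
    [AddCommGroup P] [Module R P] (β : M →ₗ[R] N →ₗ[R] P) (X : H ⊗[R] H →ₗ[R] M)
    (Y : H ⊗[R] H →ₗ[R] N) (h : H) {ι : Type*} (r : Coalgebra.Repr R h ι) :
    bconv β X Y ∘ₗ TensorProduct.mk R H H h = ∑ i ∈ r.index,
      bconv β (X ∘ₗ TensorProduct.mk R H H (r.left i))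
        (Y ∘ₗ TensorProduct.mk R H H (r.right i)) := by
  ext l
  simp only [LinearMap.sum_apply, bconv_apply_repr _ _ _ (ℛ R l)]
  rw [Finset.sum_comm]
  simp [bconv, TensorProduct.comul_tmul, ← r.eq, ← (ℛ R l).eq, TensorProduct.sum_tmul,
    TensorProduct.tmul_sum, TensorProduct.AlgebraTensorModule.tensorTensorTensorComm_eq]

/-- The map `x ⊗ l ↦ ∑ x (1 # l₁) ⊗ l₂` on `(A #_σ H) ⊗ H`. -/
def gammaShift (ω : WeakAction R H A) (σ : H ⊗[R] H →ₗ[R] A) :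
    (A ⊗[R] H) ⊗[R] H →ₗ[R] (A ⊗[R] H) ⊗[R] H :=
  TensorProduct.lift ((LinearMap.rTensorHom H ∘ₗ crossedMul ω σ).compl₂
    (bconv (TensorProduct.mk R (A ⊗[R] H) H) (TensorProduct.mk R A H 1) .id))

/-- Since `(1 # h)(1 # l) = ∑ σ(h₁ ⊗ l₁) # h₂ l₂`, the shift factors as a twist by `σ` followed by
the Galois map; both are injective. -/
theorem gammaShift_one_tmul (h : H) :
    gammaShift ω σ ∘ₗ TensorProduct.mk R (A ⊗[R] H) H (1 ⊗ₜ h) =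
      (TensorProduct.assoc R A H H).symm.toLinearMap ∘ₗ (galois R H).lTensor A ∘ₗ
        bconv (TensorProduct.mk R A (H ⊗[R] H)) σ .id ∘ₗ TensorProduct.mk R H H h := by
  have h1 : gammaShift ω σ ∘ₗ TensorProduct.mk R (A ⊗[R] H) H (1 ⊗ₜ h) =
      bconv (TensorProduct.mk R (A ⊗[R] H) H) (cocycleMul σ ∘ₗ TensorProduct.mk R H H h) .id := by
    trans (crossedMul ω σ (1 ⊗ₜ h)).rTensor H ∘ₗ
      bconv (TensorProduct.mk R (A ⊗[R] H) H) (TensorProduct.mk R A H 1) .id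
    · ext l
      simp [gammaShift]
    · rw [comp_bconv]
      ext l
      simp [bconv_apply_repr _ _ _ (ℛ R l), crossedMul_one_tmul_one_tmul]
  have h2 : ∀ q : H, galois R H ∘ₗ TensorProduct.mk R H H q =
      bconv (TensorProduct.mk R H H) (LinearMap.mulLeft R q) .id := by
    intro q
    ext l
    simp [galois, bconv_apply_repr _ _ _ (ℛ R l), ← (ℛ R l).eq, TensorProduct.tmul_sum]
  have h3 : (galois R H).lTensor A ∘ₗ bconv (TensorProduct.mk R A (H ⊗[R] H)) σ .id =
      bconv (TensorProduct.mk R A (H ⊗[R] H)) σ (galois R H) := by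
    rw [comp_bconv]
    rfl
  rw [h1, cocycleMul_eq_bconv, bconv_comp_mk _ _ _ h (ℛ R h), ← LinearMap.comp_assoc
    (TensorProduct.mk R H H h),
    h3, bconv_comp_mk _ _ _ h (ℛ R h), sum_bconv, comp_finsetSum]
  refine Finset.sum_congr rfl fun i _ => ?_
  rw [h2, comp_bconv]
  apply bconv_assoc
  intros
  rfl

theorem smul_gammaShift (a : A) (z : (A ⊗[R] H) ⊗[R] H) :
    gammaShift ω σ (a • z) = a • gammaShift ω σ z := by
  induction z using TensorProduct.induction_on with
  | zero => simp
  | add x y hx hy => simp only [smul_add, map_add, hx, hy]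
  | tmul x l =>
    simp only [gammaShift, TensorProduct.smul_tmul', TensorProduct.lift.tmul,
      LinearMap.compl₂_apply, LinearMap.comp_apply, LinearMap.coe_rTensorHom]
    generalize bconv (TensorProduct.mk R (A ⊗[R] H) H) (TensorProduct.mk R A H 1) .id l = z
    induction z using TensorProduct.induction_on with
    | zero => simp
    | add x y hx hy => simp only [smul_add, map_add, hx, hy]
    | tmul x l => simp [crossedMul_smul, TensorProduct.smul_tmul']

theorem gammaShift_injective
    (h : bconv (LinearMap.mul R A) σ σinv = Algebra.linearMap R A ∘ₗ counit) :
    Function.Injective (gammaShift ω σ) := by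
  let G : A ⊗[R] (H ⊗[R] H) →ₗ[R] A ⊗[R] (H ⊗[R] H) := (galois R H).lTensor A
  have hGs : ∀ (a : A) z, (TensorProduct.assoc R A H H).symm (G (a • z)) =
      a • (TensorProduct.assoc R A H H).symm (G z) := by
    intro a z
    induction z using TensorProduct.induction_on with
    | zero => simp
    | add x y hx hy => simp only [smul_add, map_add, hx, hy]
    | tmul b c =>
      simp only [G, TensorProduct.smul_tmul', LinearMap.lTensor_tmul]
      generalize galois R H c = c
      induction c using TensorProduct.induction_on with
      | zero => simp
      | add x y hx hy => simp only [smul_add, map_add, hx, hy, TensorProduct.tmul_add]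
      | tmul p q => simp [TensorProduct.smul_tmul']
  have key : ∀ z, gammaShift ω σ z = (TensorProduct.assoc R A H H).symm
      (G (twist σ (TensorProduct.assoc R A H H z))) := by
    intro z
    induction z using TensorProduct.induction_on with
    | zero => simp
    | add x y hx hy => simp only [map_add, hx, hy]
    | tmul x l =>
      induction x using TensorProduct.induction_on with
      | zero => simp
      | add x y hx hy => simp only [TensorProduct.add_tmul, map_add, hx, hy]
      | tmul a p =>
        have ha : (a ⊗ₜ[R] p) ⊗ₜ[R] l = a • (((1 : A) ⊗ₜ[R] p) ⊗ₜ[R] l) := by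
          simp [TensorProduct.smul_tmul']
        have h1 := congr($(gammaShift_one_tmul (σ := σ) ω p) l)
        simp only [LinearMap.comp_apply, TensorProduct.mk_apply] at h1
        rw [ha, smul_gammaShift, h1, ← ha, TensorProduct.assoc_tmul]
        simp only [twist, TensorProduct.lift.tmul, LinearMap.compl₂_apply, leftSMul_apply, hGs]
        rfl
  have hG : Function.Injective G := by
    obtain ⟨g, hg⟩ := galois_leftInverse (R := R) (H := H)
    refine Function.LeftInverse.injective (g := g.lTensor A) fun z => ?_
    rw [← LinearMap.comp_apply, ← LinearMap.lTensor_comp, hg, LinearMap.lTensor_id]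
    rfl
  intro x y hxy
  rw [key, key] at hxy
  exact (TensorProduct.assoc R A H H).injective (Function.LeftInverse.injective (twist_twist h)
    (hG ((TensorProduct.assoc R A H H).symm.injective hxy)))

/-- With `Z = γ * μ - ε 1`, associativity and `μ * γ = ε 1` give `Z * γ = 0`. The injective
`gammaShift` sends `∑ Z(k₁) ⊗ k₂` to `∑ (Z * γ)(k₁) ⊗ k₂ = 0`, whence `Z = 0`. -/
theorem gamma_bconv_gammaInv
    (h₁ : bconv (LinearMap.mul R A) σinv σ = Algebra.linearMap R A ∘ₗ counit)
    (h₂ : bconv (LinearMap.mul R A) σ σinv = Algebra.linearMap R A ∘ₗ counit)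
    (hσ : IsCrossedProduct ω σ) :
    bconv (crossedMul ω σ) (TensorProduct.mk R A H 1) (gammaInv σinv) =
      counit.smulRight (1 ⊗ₜ 1) := by
  rw [← sub_eq_zero]
  set Z := bconv (crossedMul ω σ) (TensorProduct.mk R A H 1) (gammaInv σinv) - counit.smulRight
    (1 ⊗ₜ 1) with hZ
  have hZ0 : bconv (crossedMul ω σ) Z (TensorProduct.mk R A H 1) = 0 := by
    rw [← bconvₗ_apply, hZ, map_sub, LinearMap.sub_apply, bconvₗ_apply, bconvₗ_apply,
      bconv_assoc (β₃ := crossedMul ω σ) (β₄ := crossedMul ω σ) hσ.mul_assoc,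
      gammaInv_bconv_gamma ω h₁, bconv_counit_right (f := .id), bconv_counit_left (f := .id),
      sub_self]
    · intro c y
      have : crossedMul ω σ (1 ⊗ₜ 1) y = y := hσ.one_mul y
      simp [this]
    · intro x c
      have : crossedMul ω σ x (1 ⊗ₜ 1) = x := hσ.mul_one x
      simp [this]
  have hT : gammaShift ω σ ∘ₗ bconv (TensorProduct.mk R (A ⊗[R] H) H) Z .id = 0 := by
    rw [comp_bconv]
    trans bconv (TensorProduct.mk R (A ⊗[R] H) H) (bconv (crossedMul ω σ) Z
      (TensorProduct.mk R A H 1)) .id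
    · rw [bconv_assoc (β₃ := LinearMap.rTensorHom H ∘ₗ crossedMul ω σ)
        (β₄ := TensorProduct.mk R (A ⊗[R] H) H) (by intros; simp)]
      rfl
    · rw [hZ0, ← bconvₗ_apply, map_zero, LinearMap.zero_apply]
  ext k
  have h0 : bconv (TensorProduct.mk R (A ⊗[R] H) H) Z .id k = 0 :=
    gammaShift_injective ω h₂ (by simpa using congr($hT k))
  -- Applying `ε` to the second factor of `∑ Z(k₁) ⊗ k₂ = 0` recovers `Z(k) = 0`.
  have h3 := congr(TensorProduct.rid R (A ⊗[R] H) ((counit (R := R)).lTensor (A ⊗[R] H) $h0))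
  have h4 := congr($(bconv_counit_right
    (β := (TensorProduct.mk R (A ⊗[R] H) H).compr₂ ((TensorProduct.rid R (A ⊗[R] H)).toLinearMap ∘ₗ
      (counit (R := R)).lTensor (A ⊗[R] H))) (G := .id) (f := .id) (by intros; simp) Z) k)
  rw [← comp_bconv] at h4
  exact h4.symm.trans (by simpa using h3)

end Inverse

/-! ### The maps `ψ` and the inverse -/

section Psi

variable {R : Type u} {H : Type v} {A : Type w}
variable [CommRing R] [Ring H] [HopfAlgebra R H] [Ring A] [Algebra R A]

theorem bconv_tmul_repr {M N P : Type*} [AddCommGroup M] [Module R M] [AddCommGroup N] [Module R N]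
    [AddCommGroup P] [Module R P] (β : M →ₗ[R] N →ₗ[R] P) (X : H ⊗[R] H →ₗ[R] M)
    (Y : H ⊗[R] H →ₗ[R] N) {h k : H} {ι κ : Type*} (r : Coalgebra.Repr R h ι)
    (s : Coalgebra.Repr R k κ) :
    bconv β X Y (h ⊗ₜ k) = ∑ i ∈ r.index, ∑ j ∈ s.index,
      β (X (r.left i ⊗ₜ s.left j)) (Y (r.right i ⊗ₜ s.right j)) := by
  refine congr($(bconv_comp_mk β X Y h r) k).trans ?_
  simp only [LinearMap.sum_apply, bconv_apply_repr _ _ _ s]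
  rfl

variable (ω : WeakAction R H A) (σ σinv : H ⊗[R] H →ₗ[R] A)

/-- The map `p ⊗ k ↦ ε(k) (p a)`. -/
def actCounit (a : A) : H ⊗[R] H →ₗ[R] A :=
  ω.act.flip a ∘ₗ (TensorProduct.rid R H).toLinearMap ∘ₗ counit.lTensor H

@[simp]
theorem actCounit_tmul (a : A) (p k : H) :
    actCounit ω a (p ⊗ₜ k) = counit (R := R) k • ω.act p a := by
  simp [actCounit]

theorem psiInner_eq (a : A) : psiInner ω σinv a =
    bconv (LinearMap.mul R A) σinv (actCounit ω a) ∘ₗ antipodeTmul R H := by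
  rw [← wrap_comp_antipodeTmul, wrap_eq_bconv
    (β₃ := (LinearMap.mul R A).flip ∘ₗ ω.act.flip a ∘ₗ (antipode R (A := H)))
    (β₄ := (LinearMap.lsmul R A).flip.compl₂ counit) (by intros; simp),
    bconv_counit_right (f := .id) (by intros; simp)]
  ext k
  simp [psiInner, bconv_apply_repr _ _ _ (ℛ R k), ← (ℛ R k).eq, antipodeTmul]

theorem psi_eq (h : H) (a : A) : psi ω σ σinv h a =
    bconv (LinearMap.mul R A) (bconv (LinearMap.mul R A) σinv (actCounit ω a))
      (σ ∘ₗ (LinearMap.mulRight R h).lTensor H) ∘ₗ antipodeTmul R H := by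
  rw [← wrap_comp_antipodeTmul, ← psiInner_eq, psi, wrap, ← LinearMap.comp_assoc]
  congr 1
  ext
  simp

theorem crossedMul_one_tmul_mulRight (a : A) (h : H) :
    TensorProduct.lift ((crossedMul ω σ ∘ₗ TensorProduct.mk R A H 1).compl₂
      (TensorProduct.mk R A H a ∘ₗ LinearMap.mulRight R h)) =
      bconv (leftSMul R A H) (actCounit ω a)
        (cocycleMul σ ∘ₗ (LinearMap.mulRight R h).lTensor H) := by
  ext p q
  have h1 := congr($(crossedMul_one_tmul ω σ a (q * h)) p)
  rw [bconv_apply_repr _ _ _ (ℛ R p)] at h1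
  refine h1.trans ?_
  change _ = bconv (leftSMul R A H) (actCounit ω a)
        (cocycleMul σ ∘ₗ (LinearMap.mulRight R h).lTensor H) (p ⊗ₜ q)
  rw [bconv_tmul_repr _ _ _ (ℛ R p) (ℛ R q)]
  refine Finset.sum_congr rfl fun i _ => ?_
  -- The action involves only `p`; splitting `q` with a counit in its first part turns the
  -- convolution over `H` into one over `H ⊗ H`.
  have h2 := congr($(bconv_counit_left (β := (LinearMap.lsmul R (A ⊗[R] H)))
    (F := counit (R := R) (A := H)) (f := .id) (by intros; simp)
    (leftSMul R A H (ω.act ((ℛ R p).left i) a) ∘ₗ cocycleMul σ ∘ₗ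
      TensorProduct.mk R H H ((ℛ R p).right i) ∘ₗ LinearMap.mulRight R h)) q)
  rw [bconv_apply_repr _ _ _ (ℛ R q)] at h2
  refine h2.symm.trans ?_
  simp

theorem cocycleMul_lTensor_mulRight (h : H) {ι : Type*} (r : Coalgebra.Repr R h ι) :
    cocycleMul σ ∘ₗ (LinearMap.mulRight R h).lTensor H =
      ∑ i ∈ r.index, bconv (TensorProduct.mk R A H) (σ ∘ₗ
        (LinearMap.mulRight R (r.left i)).lTensor H)
        (LinearMap.mulRight R (r.right i) ∘ₗ LinearMap.mul' R H) := by
  ext p q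
  simp only [TensorProduct.AlgebraTensorModule.curry_apply, LinearMap.restrictScalars_self,
    TensorProduct.curry_apply, LinearMap.comp_apply, LinearMap.lTensor_tmul, LinearMap.sum_apply,
    LinearMap.mulRight_apply, cocycleMul_tmul σ (ℛ R p) ((ℛ R q).mul r),
    bconv_tmul_repr _ _ _ (ℛ R p) (ℛ R q)]
  rw [Finset.sum_comm]
  simp [Finset.sum_product, mul_assoc]
  rw [Finset.sum_comm]
  exact Finset.sum_congr rfl fun _ _ => Finset.sum_comm

/-- `∑ μ(k₁)(a # k₂ h) = ∑ ψ(h₁ ⊗ a)(k₂) # S(k₁) k₃ h₂`, where `μ` is `gammaInv`. -/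
theorem bconv_gammaInv_mulRight (a : A) (h : H) {ι : Type*} (r : Coalgebra.Repr R h ι) :
    bconv (crossedMul ω σ) (gammaInv σinv) (TensorProduct.mk R A H a ∘ₗ LinearMap.mulRight R h) =
      ∑ i ∈ r.index, bconv (LinearMap.mul R (A ⊗[R] H)) (TensorProduct.mk R A H 1 ∘ₗ
        (antipode R (A := H)))
        (bconv (TensorProduct.mk R A H) (psi ω σ σinv (r.left i) a)
          (LinearMap.mulRight R (r.right i))) := by
  rw [bconv_gammaInv, crossedMul_one_tmul_mulRight, cocycleMul_lTensor_mulRight σ h r,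
    bconv_leftSMul_assoc, bconv_sum, finsetSum_comp]
  refine Finset.sum_congr rfl fun i _ => ?_
  rw [bconv_leftSMul_bconv_mk, ← wrap_comp_antipodeTmul, ← psi_eq,
    wrap_eq_bconv (β₃ := LinearMap.mul R (A ⊗[R] H) ∘ₗ TensorProduct.mk R A H 1 ∘ₗ
      (antipode R (A := H)))
      (β₄ := (TensorProduct.mk R A H).compl₂ (LinearMap.mulRight R (r.right i)))]
  · rfl
  · intros; simp [mul_assoc]

end Psi

/-! ### Injectivity and images of the restricted representations -/

section Range

variable {R : Type u} {H : Type v} {A : Type w}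
variable [CommRing R] [Ring H] [HopfAlgebra R H] [Ring A] [Algebra R A]

/-- For a multiplication `m` on `A ⊗ H`, the map `x ⊗ f ↦ [k ↦ ∑ m(1 ⊗ k₁, f(k₂) x)]`. -/
def convRep (m : A ⊗[R] H →ₗ[R] A ⊗[R] H →ₗ[R] A ⊗[R] H) (U : LeftModuleSubalgebra R H) :
    (A ⊗[R] H) ⊗[R] U.toNonUnitalSubalgebra →ₗ[R] (H →ₗ[R] A ⊗[R] H) :=
  bconvₗ m (TensorProduct.mk R A H 1) ∘ₗ evalHom U (A ⊗[R] H)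

variable {U : LeftModuleSubalgebra R H}

theorem convRep_apply (m : A ⊗[R] H →ₗ[R] A ⊗[R] H →ₗ[R] A ⊗[R] H)
    (z : (A ⊗[R] H) ⊗[R] U.toNonUnitalSubalgebra) :
    convRep m U z = bconv m (TensorProduct.mk R A H 1) (evalHom U _ z) := rfl

theorem convRep_tmul (m : A ⊗[R] H →ₗ[R] A ⊗[R] H →ₗ[R] A ⊗[R] H) (x : A ⊗[R] H)
    (f : U.toNonUnitalSubalgebra) : convRep m U (x ⊗ₜ f) =
      bconv (LinearMap.lsmul R (A ⊗[R] H)).flip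
        ((m ∘ₗ TensorProduct.mk R A H 1).flip x) f.1.ofConv := by
  ext k
  simp [convRep_apply, bconv_apply_repr _ _ _ (ℛ R k)]

/-- Convolving `γ * (f x)` on the left with an inverse of `γ` leaves the evaluation map. A left
inverse suffices. -/
theorem convRep_injective [IsNoetherianRing R]
    (hU : IsNPure (U.toSubmodule.map (toFunctions R H)) (A ⊗[R] H))
    {m : A ⊗[R] H →ₗ[R] A ⊗[R] H →ₗ[R] A ⊗[R] H} (hm : ∀ x y z, m (m x y) z = m x (m y z))
    (h1 : ∀ x, m (1 ⊗ₜ 1) x = x) {g : H →ₗ[R] A ⊗[R] H}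
    (hg : bconv m g (TensorProduct.mk R A H 1) = counit.smulRight (1 ⊗ₜ 1)) :
    Function.Injective (convRep m U) := by
  refine Function.Injective.of_comp (f := bconvₗ m g) ?_
  have : ⇑(bconvₗ m g) ∘ ⇑(convRep m U) = evalHom U (A ⊗[R] H) := by
    ext1 z
    rw [Function.comp_apply, convRep_apply, bconvₗ_apply, ← bconv_assoc hm, hg,
      bconv_counit_left (f := .id) (by intros; simp [h1])]
    rfl
  rw [this]
  exact evalHom_injective U hU

theorem exists_bconv_evalHom (z : (A ⊗[R] H) ⊗[R] U.toNonUnitalSubalgebra)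
    (f : U.toNonUnitalSubalgebra) :
    bconv (LinearMap.lsmul R (A ⊗[R] H)).flip (evalHom U _ z) f.1.ofConv =
      evalHom U _ ((LinearMap.mulRight R f).lTensor _ z) := by
  induction z using TensorProduct.induction_on with
  | zero =>
    rw [map_zero, map_zero, map_zero, ← bconvₗ_apply, map_zero, LinearMap.zero_apply]
  | add x y hx hy =>
    simp only [map_add, ← hx, ← hy]
    rw [← bconvₗ_apply, map_add, LinearMap.add_apply]
    rfl
  | tmul x g =>
    ext k
    rw [bconv_apply_repr _ _ _ (ℛ R k), LinearMap.lTensor_tmul, evalHom_tmul]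
    have : (g.1 * f.1).ofConv k = _ := (ℛ R k).convMul_apply g.1 f.1
    change _ = (g.1 * f.1).ofConv k • x
    rw [this, Finset.sum_smul]
    refine Finset.sum_congr rfl fun i _ => ?_
    exact (smul_comm _ _ _).trans
      (smul_smul (g.1.ofConv ((ℛ R k).left i)) (f.1.ofConv ((ℛ R k).right i)) x)

theorem bconv_mem_range_convRep {m : A ⊗[R] H →ₗ[R] A ⊗[R] H →ₗ[R] A ⊗[R] H}
    {F : H →ₗ[R] A ⊗[R] H} (hF : F ∈ LinearMap.range (convRep m U))
    (f : U.toNonUnitalSubalgebra) :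
    bconv (LinearMap.lsmul R (A ⊗[R] H)).flip F f.1.ofConv ∈
      LinearMap.range (convRep m U) := by
  obtain ⟨z, rfl⟩ := hF
  refine ⟨(LinearMap.mulRight R f).lTensor _ z, ?_⟩
  rw [convRep_apply, convRep_apply, ← exists_bconv_evalHom]
  symm
  apply bconv_assoc
  intros
  simp

/-- `convRep m` sends `x ⊗ f` to the convolution of `p ↦ m(1 ⊗ p, x)` with `f`, and the target range
is stable under such convolution because `U` is closed under `⋆`. Only the functions without `f`
need checking, even when `ε ∉ U`. -/
theorem range_convRep_le {m m' : A ⊗[R] H →ₗ[R] A ⊗[R] H →ₗ[R] A ⊗[R] H}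
    (h : ∀ a k, (m ∘ₗ TensorProduct.mk R A H 1).flip (a ⊗ₜ k) ∈ LinearMap.range (convRep m' U)) :
    LinearMap.range (convRep m U) ≤ LinearMap.range (convRep m' U) := by
  rintro _ ⟨z, rfl⟩
  induction z using TensorProduct.induction_on with
  | zero => simp
  | add x y hx hy => rw [map_add]; exact add_mem hx hy
  | tmul x f =>
    rw [convRep_tmul]
    refine bconv_mem_range_convRep ?_ f
    induction x using TensorProduct.induction_on with
    | zero => simp
    | add x y hx hy => rw [map_add]; exact add_mem hx hy
    | tmul a k => exact h a k

/-- For `t = a g` with `g ∈ V` the function is `k ↦ a ⊗ (k ↼ g) q`. The RL-condition rewrites it as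
`∑ a ⊗ (g_j ⇀ k) h_j q`, the image of `∑ (a ⊗ h_j q) ⊗ g_j`. -/
theorem bconv_mulRight_mem_range {V : Submodule R (ConvDual R H)} (hV : RLCondition V U)
    {t : H →ₗ[R] A} (ht : t ∈ LinearMap.range (canonicalJ A V)) (q : H) :
    bconv (TensorProduct.mk R A H) t (LinearMap.mulRight R q) ∈
      LinearMap.range (convRep (LinearMap.mul R (A ⊗[R] H)) U) := by
  obtain ⟨s, rfl⟩ := ht
  rw [← bconvₗ_apply]
  induction s using TensorProduct.induction_on with
  | zero => simp
  | add x y hx hy => rw [map_add, map_add, LinearMap.add_apply]; exact add_mem hx hy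
  | tmul a g =>
    obtain ⟨s, hs⟩ := hV g.1 g.2
    have h1 : bconvₗ (TensorProduct.mk R A H) (canonicalJ A V (a ⊗ₜ g)) (LinearMap.mulRight R q) =
        TensorProduct.mk R A H a ∘ₗ LinearMap.mulRight R q ∘ₗ lambdaBar U s := by
      rw [hs]
      ext k
      simp [canonicalJ, hitRight, bconv_apply_repr _ _ _ (ℛ R k), ← (ℛ R k).eq,
        TensorProduct.smul_tmul']
    rw [h1]
    clear h1 hs
    induction s using TensorProduct.induction_on with
    | zero => simp
    | add x y hx hy =>
      rw [map_add, LinearMap.comp_add, LinearMap.comp_add]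
      exact add_mem hx hy
    | tmul h' g' =>
      refine ⟨(a ⊗ₜ (h' * q)) ⊗ₜ g', ?_⟩
      ext k
      simp [convRep_apply, lambdaBar, hitLeft, bconv_apply_repr _ _ _ (ℛ R k), ← (ℛ R k).eq,
        mul_assoc]

theorem bconv_tmul_antipode : bconv (LinearMap.mul R (A ⊗[R] H))
    (TensorProduct.mk R A H 1 ∘ₗ (antipode R (A := H))) (TensorProduct.mk R A H 1) =
    counit.smulRight (1 ⊗ₜ 1) := by
  trans TensorProduct.mk R A H 1 ∘ₗ bconv (LinearMap.mul R H) (antipode R (A := H)) .id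
  · ext k
    simp [bconv_apply_repr _ _ _ (ℛ R k)]
  · rw [bconv_antipode_id]
    ext k
    simp [Algebra.algebraMap_eq_smul_one]

theorem range_convRep_eq {ω : WeakAction R H A} {σ : (WithConv (H ⊗[R] H →ₗ[R] A))ˣ}
    (hσ : IsCrossedProduct ω σ.val.ofConv) {V : Submodule R (ConvDual R H)}
    (hV : Compatible ω σ V U) :
    LinearMap.range (convRep (crossedMul ω σ.val.ofConv) U) =
      LinearMap.range (convRep (LinearMap.mul R (A ⊗[R] H)) U) := by
  have e₁ : bconv (LinearMap.mul R A) σ.inv.ofConv σ.val.ofConv =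
      Algebra.linearMap R A ∘ₗ counit := by rw [bconv_mul_eq, σ.inv_val]; rfl
  have e₂ : bconv (LinearMap.mul R A) σ.val.ofConv σ.inv.ofConv =
      Algebra.linearMap R A ∘ₗ counit := by rw [bconv_mul_eq, σ.val_inv]; rfl
  apply le_antisymm
  · refine range_convRep_le fun a k => ?_
    rw [crossedMul_one_tmul_eq_sum_phi ω _ a k (ℛ R k)]
    exact sum_mem fun i _ => bconv_mulRight_mem_range hV.rl (hV.phi_mem _ a) _
  · refine range_convRep_le fun a k => ?_
    have h1 : (LinearMap.mul R (A ⊗[R] H) ∘ₗ TensorProduct.mk R A H 1).flip (a ⊗ₜ k) =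
        TensorProduct.mk R A H a ∘ₗ LinearMap.mulRight R k := by
      ext p; simp
    -- It suffices to place `μ * D`, for `D(p) = a ⊗ p k`, in the range of `evalHom`, since `D = γ *
    -- (μ * D)`.
    have h2 : bconv (crossedMul ω σ.val.ofConv) (gammaInv σ.inv.ofConv)
        (TensorProduct.mk R A H a ∘ₗ LinearMap.mulRight R k) ∈ LinearMap.range
          (evalHom U (A ⊗[R] H)) := by
      rw [bconv_gammaInv_mulRight ω _ _ a k (ℛ R k)]
      refine sum_mem fun i _ => ?_
      obtain ⟨z, hz⟩ := bconv_mulRight_mem_range hV.rl (hV.psi_mem ((ℛ R k).left i) a)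
        ((ℛ R k).right i)
      refine ⟨z, ?_⟩
      -- The prefactor `1 ⊗ S` left over from `μ` cancels the factor `1 ⊗ k` built into `convRep`
      -- for the ordinary product, so only an evaluation map remains.
      rw [← hz, convRep_apply, ← bconv_assoc (β₁ := LinearMap.mul R (A ⊗[R] H))
        (β₂ := LinearMap.mul R (A ⊗[R] H)) (by intros; simp [mul_assoc]),
        bconv_tmul_antipode, bconv_counit_left (f := .id)]
      · rfl
      · intros
        simp [← Algebra.TensorProduct.one_def]
    obtain ⟨z, hz⟩ := h2
    refine ⟨z, ?_⟩
    rw [convRep_apply, hz, h1, ← bconv_assoc (β₁ := crossedMul ω σ.val.ofConv)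
      (β₂ := crossedMul ω σ.val.ofConv) hσ.mul_assoc, gamma_bconv_gammaInv ω e₁ e₂ hσ,
      bconv_counit_left (f := .id)]
    · rfl
    · intro c y
      have : crossedMul ω σ.val.ofConv (1 ⊗ₜ 1) y = y := hσ.one_mul y
      simp [this]

end Range

/-! ### The isomorphism -/

section Iso

variable {R : Type u} {H : Type v} {A : Type w}
variable [CommRing R] [Ring H] [HopfAlgebra R H] [Ring A] [Algebra R A]

/-- `A`-linearity of an `R`-linear endomorphism of `A ⊗ H`. -/
def IsLeftLinear (T : A ⊗[R] H →ₗ[R] A ⊗[R] H) : Prop := ∀ (a : A) x, T (a • x) = a • T x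

theorem IsLeftLinear.ext {T T' : A ⊗[R] H →ₗ[R] A ⊗[R] H} (hT : IsLeftLinear T)
    (hT' : IsLeftLinear T') (h : T ∘ₗ TensorProduct.mk R A H 1 = T' ∘ₗ
      TensorProduct.mk R A H 1) : T = T' := by
  ext a k
  have ha : (a ⊗ₜ[R] k : A ⊗[R] H) = a • ((1 : A) ⊗ₜ[R] k) := by simp [TensorProduct.smul_tmul']
  have h1 := congr($h k)
  simp only [LinearMap.comp_apply, TensorProduct.mk_apply] at h1
  simp only [TensorProduct.AlgebraTensorModule.curry_apply, LinearMap.restrictScalars_self,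
    TensorProduct.curry_apply]
  rw [ha, hT, hT', h1]

variable (U : LeftModuleSubalgebra R H)

theorem opRep_comul_mul (x y : H ⊗[R] U.toNonUnitalSubalgebra) :
    opRep comul U (opMul comul U x y) = opRep comul U y ∘ₗ opRep comul U x := by
  have h := opRep_mul (R := R) (B := H) (ρ := (comul : H →ₗ[R] H ⊗[R] H))
    (fun x y z => mul_assoc x y z) Coalgebra.coassoc Bialgebra.comul_mul U x y
  exact h

/-- The map `A ⊗ (H #^op U) → End_R(A ⊗ H)`, `a ⊗ (h # f) ↦ [b ⊗ k ↦ ∑ b a ⊗ k₁ f(k₂) h]`. -/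
def tensorRep (A : Type w) [Ring A] [Algebra R A] (U : LeftModuleSubalgebra R H) :
    A ⊗[R] (H ⊗[R] U.toNonUnitalSubalgebra) →ₗ[R] (A ⊗[R] H →ₗ[R] A ⊗[R] H) :=
  TensorProduct.homTensorHomMap (RingHom.id R) A H A H ∘ₗ
    TensorProduct.map (LinearMap.mul R A).flip (opRep comul U)

theorem tensorRep_tmul (a : A) (y : H ⊗[R] U.toNonUnitalSubalgebra) :
    tensorRep A U (a ⊗ₜ y) = TensorProduct.map (LinearMap.mulRight R a) (opRep comul U y) := rfl

theorem tmul_mul_tmul_opSmash (a b : A) (x y : OpSmash (comul (R := R) (A := H)) U) :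
    (a ⊗ₜ[R] x : A ⊗[R] OpSmash (comul (R := R) (A := H)) U) * (b ⊗ₜ[R] y) =
      (a * b) ⊗ₜ[R] (x * y) :=
  Algebra.TensorProduct.tmul_mul_tmul a b x y

theorem tensorRep_mul (x y : A ⊗[R] OpSmash (comul (R := R) (A := H)) U) :
    tensorRep A U (x * y : A ⊗[R] OpSmash (comul (R := R) (A := H)) U) =
      tensorRep A U y ∘ₗ tensorRep A U x := by
  suffices h : ((LinearMap.mul R (A ⊗[R] OpSmash (comul (R := R) (A := H)) U)).compr₂
      (tensorRep A U)) = ((LinearMap.llcomp R (A ⊗[R] H) (A ⊗[R] H) (A ⊗[R] H)).flip.compl₁₂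
        (tensorRep A U) (tensorRep A U)) from congr($h x y)
  have key : ∀ (a b : A) (x y : H ⊗[R] U.toNonUnitalSubalgebra),
      tensorRep A U ((a * b) ⊗ₜ opMul comul U x y) =
        tensorRep A U (b ⊗ₜ y) ∘ₗ tensorRep A U (a ⊗ₜ x) := by
    intro a b x y
    rw [tensorRep_tmul, tensorRep_tmul, tensorRep_tmul, ← TensorProduct.map_comp,
      opRep_comul_mul, LinearMap.mulRight_mul]
  refine TensorProduct.ext' fun a x => TensorProduct.ext' fun b y => ?_
  exact (congrArg (tensorRep A U) (tmul_mul_tmul_opSmash U a b x y)).trans (key a b x y)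

theorem isLeftLinear_tensorRep (y : A ⊗[R] (H ⊗[R] U.toNonUnitalSubalgebra)) :
    IsLeftLinear (tensorRep A U y) := by
  intro a x
  induction y using TensorProduct.induction_on with
  | zero => simp
  | add y z hy hz => simp only [map_add, LinearMap.add_apply, hy, hz, smul_add]
  | tmul b y =>
    induction x using TensorProduct.induction_on with
    | zero => simp
    | add x z hx hz => simp only [map_add, hx, hz, smul_add]
    | tmul c k => simp [tensorRep_tmul, TensorProduct.smul_tmul', mul_assoc]

theorem tensorRep_comp_mk (y : A ⊗[R] (H ⊗[R] U.toNonUnitalSubalgebra)) :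
    tensorRep A U y ∘ₗ TensorProduct.mk R A H 1 = convRep (LinearMap.mul R (A ⊗[R] H)) U
      ((TensorProduct.assoc R A H U.toNonUnitalSubalgebra).symm y) := by
  obtain ⟨y, rfl⟩ := (TensorProduct.assoc R A H U.toNonUnitalSubalgebra).surjective y
  rw [LinearEquiv.symm_apply_apply]
  induction y using TensorProduct.induction_on with
  | zero => simp
  | add y z hy hz => simp only [map_add, LinearMap.add_comp, hy, hz]
  | tmul x f =>
    induction x using TensorProduct.induction_on with
    | zero => simp
    | add y z hy hz => simp only [map_add, TensorProduct.add_tmul, LinearMap.add_comp, hy, hz]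
    | tmul a h =>
      ext k
      simp [tensorRep_tmul, convRep_tmul, hit_apply, bconv_apply_repr _ _ _ (ℛ R k),
        ← (ℛ R k).eq, Finset.sum_mul, TensorProduct.tmul_sum]

variable (ω : WeakAction R H A) (σ : H ⊗[R] H →ₗ[R] A)

/-- The map `opRep` for the crossed product, on the underlying module `A ⊗ H`. -/
def crossedRep : (A ⊗[R] H) ⊗[R] U.toNonUnitalSubalgebra →ₗ[R] (A ⊗[R] H →ₗ[R] A ⊗[R] H) :=
  opRep (CrossedProduct.coaction ω σ) U

theorem crossedRep_tmul (x : A ⊗[R] H) (f : U.toNonUnitalSubalgebra) (y : A ⊗[R] H) :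
    crossedRep U ω σ (x ⊗ₜ f) y = crossedMul ω σ
      (TensorProduct.rid R (A ⊗[R] H) (f.1.ofConv.lTensor (A ⊗[R] H)
        ((TensorProduct.assoc R A H H).symm (comul.lTensor A y)))) x := rfl

theorem hit_coaction_tmul (f : ConvDual R H) (a : A) (k : H) :
    TensorProduct.rid R (A ⊗[R] H) (f.ofConv.lTensor (A ⊗[R] H)
      ((TensorProduct.assoc R A H H).symm (comul.lTensor A (a ⊗ₜ k)))) = a ⊗ₜ hitLeft f k := by
  simp [hitLeft, ← (ℛ R k).eq, TensorProduct.tmul_sum]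

theorem isLeftLinear_crossedRep (z : (A ⊗[R] H) ⊗[R] U.toNonUnitalSubalgebra) :
    IsLeftLinear (crossedRep U ω σ z) := by
  intro a x
  induction z using TensorProduct.induction_on with
  | zero => simp
  | add y z hy hz => simp only [map_add, LinearMap.add_apply, hy, hz, smul_add]
  | tmul y f =>
    induction x using TensorProduct.induction_on with
    | zero => simp
    | add x z hx hz => simp only [map_add, hx, hz, smul_add]
    | tmul c k =>
      rw [TensorProduct.smul_tmul', crossedRep_tmul, crossedRep_tmul, hit_coaction_tmul,
        hit_coaction_tmul, ← TensorProduct.smul_tmul', crossedMul_smul]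

theorem crossedRep_comp_mk (z : (A ⊗[R] H) ⊗[R] U.toNonUnitalSubalgebra) :
    crossedRep U ω σ z ∘ₗ TensorProduct.mk R A H 1 = convRep (crossedMul ω σ) U z := by
  induction z using TensorProduct.induction_on with
  | zero => simp
  | add y z hy hz => simp only [map_add, LinearMap.add_comp, hy, hz]
  | tmul x f =>
    ext k
    rw [LinearMap.comp_apply, TensorProduct.mk_apply, crossedRep_tmul, hit_coaction_tmul,
      convRep_tmul, bconv_apply_repr _ _ _ (ℛ R k)]
    simp [hitLeft, ← (ℛ R k).eq, TensorProduct.tmul_sum]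

variable {U ω}

/-- The restricted representations are injective with equal range, so one composed with the inverse
of the other is an equivalence. Left `A`-linearity then upgrades agreement on the elements `1 ⊗ k`
to agreement of the full operators. -/
theorem exists_linearEquiv [IsNoetherianRing R] {σ : (WithConv (H ⊗[R] H →ₗ[R] A))ˣ}
    (hσ : IsCrossedProduct ω σ.val.ofConv) {V : Submodule R (ConvDual R H)}
    (hV : Compatible ω σ V U) (hU : IsNPure (U.toSubmodule.map (toFunctions R H)) (A ⊗[R] H)) :
    ∃ e : (A ⊗[R] H) ⊗[R] U.toNonUnitalSubalgebra ≃ₗ[R]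
        A ⊗[R] (H ⊗[R] U.toNonUnitalSubalgebra),
      (∀ z, tensorRep A U (e z) = crossedRep U ω σ.val.ofConv z) ∧
        Function.Injective (tensorRep A U) := by
  have e₁ : bconv (LinearMap.mul R A) σ.inv.ofConv σ.val.ofConv =
      Algebra.linearMap R A ∘ₗ counit := by rw [bconv_mul_eq, σ.inv_val]; rfl
  have inj₁ : Function.Injective (convRep (crossedMul ω σ.val.ofConv) U) :=
    convRep_injective hU hσ.mul_assoc hσ.one_mul (gammaInv_bconv_gamma ω e₁)
  have inj₂ : Function.Injective (convRep (LinearMap.mul R (A ⊗[R] H)) U) :=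
    convRep_injective hU (fun x y z => mul_assoc x y z)
      (fun x => one_mul x) bconv_tmul_antipode
  let e : (A ⊗[R] H) ⊗[R] U.toNonUnitalSubalgebra ≃ₗ[R]
      (A ⊗[R] H) ⊗[R] U.toNonUnitalSubalgebra :=
    LinearEquiv.ofInjective _ inj₁ ≪≫ₗ LinearEquiv.ofEq _ _ (range_convRep_eq hσ hV) ≪≫ₗ
      (LinearEquiv.ofInjective _ inj₂).symm
  have he : ∀ z, convRep (LinearMap.mul R (A ⊗[R] H)) U (e z) =
      convRep (crossedMul ω σ.val.ofConv) U z := fun z =>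
    congrArg Subtype.val (LinearEquiv.apply_symm_apply (LinearEquiv.ofInjective _ inj₂)
      (LinearEquiv.ofEq _ _ (range_convRep_eq hσ hV) (LinearEquiv.ofInjective _ inj₁ z)))
  refine ⟨e ≪≫ₗ TensorProduct.assoc R A H U.toNonUnitalSubalgebra, fun z => ?_, fun x y hxy => ?_⟩
  · refine IsLeftLinear.ext (isLeftLinear_tensorRep U _) (isLeftLinear_crossedRep U ω _ z) ?_
    rw [tensorRep_comp_mk, crossedRep_comp_mk, ← he, LinearEquiv.trans_apply,
      LinearEquiv.symm_apply_apply]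
  · refine (TensorProduct.assoc R A H U.toNonUnitalSubalgebra).symm.injective (inj₂ ?_)
    rw [← tensorRep_comp_mk, ← tensorRep_comp_mk, hxy]

theorem hitLeft_one (k : H) : hitLeft (1 : ConvDual R H) k = k := by
  have : (1 : ConvDual R H).ofConv = counit := by ext; rfl
  simp [hitLeft, this]

theorem tensorRep_one (hε : (1 : ConvDual R H) ∈ U.toNonUnitalSubalgebra) :
    tensorRep A U (1 ⊗ₜ (1 ⊗ₜ ⟨1, hε⟩)) = .id := by
  refine TensorProduct.ext' fun a k => ?_
  have : hit comul (1 : ConvDual R H) k = k := hitLeft_one k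
  simp [tensorRep_tmul, this]

theorem crossedRep_one {σ : H ⊗[R] H →ₗ[R] A} (hσ : IsCrossedProduct ω σ)
    (hε : (1 : ConvDual R H) ∈ U.toNonUnitalSubalgebra) :
    crossedRep U ω σ ((1 ⊗ₜ 1) ⊗ₜ ⟨1, hε⟩) = .id := by
  refine TensorProduct.ext' fun a k => ?_
  rw [crossedRep_tmul, hit_coaction_tmul, hitLeft_one]
  exact hσ.mul_one _

end Iso

end OppositeSmash

end

theorem mainTheorem3 {R : Type u} {H : Type v} {A : Type w} [CommRing R] [IsNoetherianRing R]
    [Ring H] [HopfAlgebra R H] [Ring A] [Algebra R A]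
    (ω : OppositeSmash.WeakAction R H A) (σ : (WithConv (H ⊗[R] H →ₗ[R] A))ˣ)
    (hσ : OppositeSmash.IsCrossedProduct ω σ.val.ofConv)
    (U : OppositeSmash.LeftModuleSubalgebra R H)
    (hV : ∃ V : Submodule R (OppositeSmash.ConvDual R H), OppositeSmash.Compatible ω σ V U) :
    (OppositeSmash.IsNPure (U.toSubmodule.map (OppositeSmash.toFunctions R H)) (A ⊗[R] H) →
      ∃ e : OppositeSmash.OpSmash (OppositeSmash.CrossedProduct.coaction ω σ.val.ofConv) U ≃ₗ[R]
          A ⊗[R] OppositeSmash.OpSmash (comul (R := R) (A := H)) U,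
        (∀ x y, e (x * y) = e x * e y) ∧
        ∀ hε : (1 : OppositeSmash.ConvDual R H) ∈ U.toNonUnitalSubalgebra,
          e (OppositeSmash.OpSmash.mk _ U
              (OppositeSmash.CrossedProduct.mk ω σ.val.ofConv 1 1) ⟨1, hε⟩) =
            1 ⊗ₜ[R] OppositeSmash.OpSmash.mk _ U 1 ⟨1, hε⟩) ∧
    (OppositeSmash.IsHopfAlphaAlgebra.{u, v, max u v w} R H →
      OppositeSmash.IsSubbialgebra.{u, v, max u v w} U →
      OppositeSmash.IsNPure (U.toSubmodule.map (OppositeSmash.toFunctions R H)) (A ⊗[R] H)) := by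
  obtain ⟨V, hV⟩ := hV
  refine ⟨fun hU => ?_, OppositeSmash.isNPure_of_isSubbialgebra⟩
  obtain ⟨e, he, inj⟩ := OppositeSmash.exists_linearEquiv hσ hV hU
  -- Both identities are tested in `End_R(A ⊗ H)`: the reversal of composition occurs in both
  -- representations and so disappears, and both unities act as the identity.
  refine ⟨e, fun x y => inj ?_, fun hε => inj ?_⟩
  · exact (he _).trans ((OppositeSmash.opRep_mul hσ.mul_assoc
      (OppositeSmash.coaction_coassoc ω σ.val.ofConv) (OppositeSmash.coaction_mul ω σ.val.ofConv)
      U x y).trans ((congrArg₂ (fun f g => f ∘ₗ g) (he y).symm (he x).symm).trans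
        (OppositeSmash.tensorRep_mul U (e x) (e y)).symm))
  · exact (he _).trans ((OppositeSmash.crossedRep_one hσ hε).trans
      (OppositeSmash.tensorRep_one hε).symm)
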